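/- **Theorem 2.1.** All rings are commutative with identity. Let $r\ge 1$, and let $S=\bigoplus_{\underline n\in\mathbb N^r}S_{\underline n}$ be a Noetherian standard $\mathbb N^r$-graded ring with $S_{\underline 0}=R$; here standard means that $S$ is generated as an $R$-algebra by its components $S_{e_1},\dots,S_{e_r}$, where $e_1,\dots,e_r$ is the standard basis of $\mathbb Z^r$. Let $\mathscr M=\bigoplus_{\underline n\in\mathbb Z^r}\mathscr M_{\underline n}$ be a finitely generated $\mathbb Z^r$-graded $S$-module. Let $F$ be a coherent functor on the category of finitely generated $R$-modules, i.e. a covariant $R$-linear functor for which there are finitely generated $R$-modules $K,L$ and an exact sequence of functors $\operatorname{Hom}_R(K,-)\to\operatorname{Hom}_R(L,-)\to F\to 0$. Then $F(\mathscr M):=\bigoplus_{\underline n\in\mathbb Z^r}F(\mathscr M_{\underline n})$, on which $s\in S_{\underline i}$ acts through the maps $F(\mathscr M_{\underline n})\to F(\mathscr M_{\underline i+\underline n})$ obtained by applying $F$ to multiplication by $s$, is a finitely generated $\mathbb Z^r$-graded $S$-module. Furthermore, where "for all $\underline n\gg 0$" means "for all $\underline n\ge\underline c$ (componentwise), for some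 $\underline c\in\mathbb N^r$": 1. The set $\operatorname{Ass}_R(F(\mathscr M_{\underline n}))$ is the same for all $\underline n\gg 0$. 2. For every non-zero ideal $J$ of $R$, the value $\operatorname{grade}(J,F(\mathscr M_{\underline n}))\in\mathbb N\cup\{\infty\}$ is the same for all $\underline n\gg 0$. Here $\operatorname{grade}(J,N)$ is the supremum of the lengths of $N$-regular sequences in $J$ if $JN\ne N$, and $\infty$ if $JN=N$. 3. If the length $\lambda_R(F(\mathscr M_{\underline n}))$ is finite for all $\underline n\gg 0$, then there exists a polynomial $P$ in $r$ variables over $\mathbb Q$ such that $\lambda_R(F(\mathscr M_{\underline n}))=P(\underline n)$ for all $\underline n\gg 0$. -/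

import Mathlib

open CategoryTheory
open scoped DirectSum

universe u v

/-- The inclusion of multidegrees `ℕ^r ⊆ ℤ^r`. -/
def natDeg {r : ℕ} (i : Fin r → ℕ) : Fin r → ℤ := fun k => (i k : ℤ)

/-- The algebra `S`, graded by `ℕ^r` through `𝒜`, is standard graded with `S_0 = R`: the structure
map identifies `R` with the degree zero component, and `S` is generated as an `R`-algebra by its
components of degrees `e_1, …, e_r` (the standard basis vectors). -/
structure IsStandardGraded {r : ℕ} {R : Type u} {S : Type v} [CommRing R] [CommRing S]
    [Algebra R S] (𝒜 : (Fin r → ℕ) → Submodule R S) [GradedAlgebra 𝒜] : Prop where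
  algebraMap_injective : Function.Injective (algebraMap R S)
  degree_zero : ∀ s ∈ 𝒜 0, ∃ a : R, algebraMap R S a = s
  generated : Algebra.adjoin R (⋃ k : Fin r, (𝒜 (Pi.single k 1) : Set S)) = ⊤

/-- The submodules `ℳ n`, `n ∈ ℤ^r`, make the `S`-module `M` a `ℤ^r`-graded module over the
`ℕ^r`-graded algebra `S`: `M` is their internal direct sum, and `S_i • M_n ⊆ M_{i + n}`. -/
structure IsMultigradedModule {r : ℕ} {R : Type u} {S : Type v} {M : Type*} [CommRing R]
    [CommRing S] [Algebra R S] [AddCommGroup M] [Module R M] [Module S M]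
    (𝒜 : (Fin r → ℕ) → Submodule R S) (ℳ : (Fin r → ℤ) → Submodule R M) : Prop where
  isInternal : DirectSum.IsInternal ℳ
  smul_mem : ∀ (i : Fin r → ℕ) (n : Fin r → ℤ) (s : S) (x : M),
    s ∈ 𝒜 i → x ∈ ℳ n → s • x ∈ ℳ (natDeg i + n)

/-- An `R`-linear functor `F` on finitely generated `R`-modules is coherent if there are finitely
generated modules `K`, `L` and an exact sequence of functors
`Hom_R(K, -) ⟶ Hom_R(L, -) ⟶ F ⟶ 0`, exactness being exactness at every finitely generated module.
The functor is allowed to take values in arbitrary modules; an endofunctor of the category of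
finitely generated modules is regarded as such by composing with the inclusion. -/
def IsCoherentFunctor {R : Type u} [CommRing R] (F : FGModuleCat.{u} R ⥤ ModuleCat.{u} R)
    [F.Additive] [F.Linear R] : Prop :=
  ∃ (K L : FGModuleCat.{u} R)
    (φ : (linearCoyoneda R (FGModuleCat.{u} R)).obj (Opposite.op K) ⟶
      (linearCoyoneda R (FGModuleCat.{u} R)).obj (Opposite.op L))
    (π : (linearCoyoneda R (FGModuleCat.{u} R)).obj (Opposite.op L) ⟶ F),
    ∀ N : FGModuleCat.{u} R,
      Function.Exact (φ.app N).hom (π.app N).hom ∧ Function.Surjective (π.app N).hom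

/-- `x n` is constant for all `n ≫ 0`, i.e. for all `n ≥ c` for some `c ∈ ℕ^r`. -/
def StabilizesAsymptotically {r : ℕ} {X : Type*} (x : (Fin r → ℤ) → X) : Prop :=
  ∃ c : Fin r → ℕ, ∀ n : Fin r → ℤ, natDeg c ≤ n → x n = x (natDeg c)

open Classical in
/-- The grade of the ideal `J` on the module `N`: the supremum of the lengths of the `N`-regular
sequences contained in `J` if `J N ≠ N`, and `∞` if `J N = N`. -/
noncomputable def moduleGrade {R : Type u} [CommRing R] (J : Ideal R) (N : Type*) [AddCommGroup N]
    [Module R N] : ℕ∞ :=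
  if J • (⊤ : Submodule R N) = ⊤ then ⊤
  else ⨆ (l : List R) (_ : (∀ a ∈ l, a ∈ J) ∧ RingTheory.Sequence.IsRegular N l), (l.length : ℕ∞)

section Pieces

variable {r : ℕ} {R : Type u} {S : Type v} {M : Type u} [CommRing R] [CommRing S] [Algebra R S]
  [AddCommGroup M] [Module R M] [Module S M] [IsScalarTower R S M]
  {𝒜 : (Fin r → ℕ) → Submodule R S} [GradedAlgebra 𝒜] {ℳ : (Fin r → ℤ) → Submodule R M}

theorem natDeg_zero : natDeg (0 : Fin r → ℕ) = 0 := rfl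

theorem natDeg_add (i j : Fin r → ℕ) : natDeg (i + j) = natDeg i + natDeg j := by
  funext k; simp [natDeg]

theorem natDeg_eq_zero {i : Fin r → ℕ} (h : natDeg i = 0) : i = 0 := by
  funext k; have := congrFun h k; simpa [natDeg] using this

/-- A finitely generated graded module over a Noetherian standard graded ring has finitely
generated components. -/
theorem gradedPiece_finite [IsNoetherianRing S] [Module.Finite S M] (h𝒜 : IsStandardGraded 𝒜)
    (hℳ : IsMultigradedModule 𝒜 ℳ) (n : Fin r → ℤ) : Module.Finite R (ℳ n) := by
  have key : ∀ (N : Submodule R (ℳ n)) (x : ℳ n),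
      (x : M) ∈ Submodule.span S ((fun y : ℳ n => (y : M)) '' (N : Set (ℳ n))) → x ∈ N := by
    intro N x hx
    let := hℳ.isInternal.chooseDecomposition
    have h1 : ∀ y ∈ N, ∀ s : S, DirectSum.decompose ℳ (s • (y : M)) n ∈ N := by
      intro y hy s
      induction s using DirectSum.Decomposition.inductionOn 𝒜 with
      | zero => simp
      | @homogeneous i a =>
        have hmem := hℳ.smul_mem i n a y a.2 y.2
        by_cases hi : i = 0
        · subst hi
          obtain ⟨b, hb⟩ := h𝒜.degree_zero a a.2
          have : (a : S) • (y : M) = ((b • y : ℳ n) : M) := by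
            rw [← hb, algebraMap_smul]; rfl
          rw [this, DirectSum.decompose_coe, DirectSum.of_eq_same]
          exact N.smul_mem b hy
        · have hne : natDeg i + n ≠ n := fun h => hi (natDeg_eq_zero (by simpa using h))
          have : DirectSum.decompose ℳ ((a : S) • (y : M)) n = 0 := by
            ext; exact DirectSum.decompose_of_mem_ne ℳ hmem hne
          rw [this]; exact N.zero_mem
      | add a b ha hb =>
        rw [add_smul, DirectSum.decompose_add, DirectSum.add_apply]; exact N.add_mem ha hb
    have h2 : ∀ z ∈ Submodule.span S ((fun y : ℳ n => (y : M)) '' (N : Set (ℳ n))),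
        ∀ s : S, DirectSum.decompose ℳ (s • z) n ∈ N := by
      intro z hz
      induction hz using Submodule.span_induction with
      | mem z hz => obtain ⟨y, hy, rfl⟩ := hz; exact h1 y hy
      | zero => intro s; simp
      | add a b _ _ ha hb =>
        intro s; rw [smul_add, DirectSum.decompose_add, DirectSum.add_apply]; exact N.add_mem (ha s) (hb s)
      | smul t z _ hz => intro s; rw [smul_smul]; exact hz _
    have := h2 x hx 1
    rwa [one_smul, DirectSum.decompose_coe, DirectSum.of_eq_same] at this
  have : IsNoetherian S M := inferInstance
  have : IsNoetherian R (ℳ n) := by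
    rw [isNoetherian_iff'] at this ⊢
    let g : Submodule R (ℳ n) → Submodule S M := fun N =>
      Submodule.span S ((fun y : ℳ n => (y : M)) '' (N : Set (ℳ n)))
    have hg : Monotone g := fun A B h => Submodule.span_mono (Set.image_mono h)
    have hinj : Function.Injective g := by
      intro A B h
      ext x
      have hA : x ∈ A → (x : M) ∈ g A := fun hx => Submodule.subset_span ⟨x, hx, rfl⟩
      have hB : x ∈ B → (x : M) ∈ g B := fun hx => Submodule.subset_span ⟨x, hx, rfl⟩
      rw [← h] at hB
      rw [h] at hA
      exact ⟨fun hx => key B x (hA hx), fun hx => key A x (hB hx)⟩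
    exact (hg.strictMono_of_injective hinj).wellFoundedGT
  infer_instance

/-- The component `M_n` as an object of the category of finitely generated `R`-modules. -/
def gradedPiece [IsNoetherianRing S] [Module.Finite S M] (h𝒜 : IsStandardGraded 𝒜)
    (hℳ : IsMultigradedModule 𝒜 ℳ) (n : Fin r → ℤ) : FGModuleCat.{u} R :=
  ⟨ModuleCat.of R (ℳ n), gradedPiece_finite h𝒜 hℳ n⟩

/-- Multiplication by `s ∈ S`, as a linear map `M_n ⟶ M_m`, if it maps `M_n` into `M_m`. -/
def gradedPieceMul [IsNoetherianRing S] [Module.Finite S M] (h𝒜 : IsStandardGraded 𝒜)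
    (hℳ : IsMultigradedModule 𝒜 ℳ) (s : S) {n m : Fin r → ℤ} (h : ∀ x ∈ ℳ n, s • x ∈ ℳ m) :
    gradedPiece h𝒜 hℳ n ⟶ gradedPiece h𝒜 hℳ m :=
  ⟨ModuleCat.ofHom (X := ℳ n) (Y := ℳ m) ((Algebra.lsmul R R M s).restrict h)⟩

variable [IsNoetherianRing S] [Module.Finite S M] (h𝒜 : IsStandardGraded 𝒜)
  (hℳ : IsMultigradedModule 𝒜 ℳ) (F : FGModuleCat.{u} R ⥤ ModuleCat.{u} R)

/-- The direct sum `F(M) = ⨁ F(M_n)` over `n ∈ ℤ^r`. -/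
def FunctorSum : Type u := ⨁ n : Fin r → ℤ, F.obj (gradedPiece h𝒜 hℳ n)

namespace FunctorSum

noncomputable instance : AddCommGroup (FunctorSum h𝒜 hℳ F) :=
  inferInstanceAs (AddCommGroup (⨁ n : Fin r → ℤ, F.obj (gradedPiece h𝒜 hℳ n)))

noncomputable instance : Module R (FunctorSum h𝒜 hℳ F) :=
  inferInstanceAs (Module R (⨁ n : Fin r → ℤ, F.obj (gradedPiece h𝒜 hℳ n)))

/-- The inclusion `F(M_n) ⟶ F(M)`. -/
noncomputable def of (n : Fin r → ℤ) :
    F.obj (gradedPiece h𝒜 hℳ n) →ₗ[R] FunctorSum h𝒜 hℳ F :=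
  DirectSum.lof R (Fin r → ℤ) (fun n => F.obj (gradedPiece h𝒜 hℳ n)) n

/-- The summand `F(M_n)` of `F(M)`. -/
noncomputable def component (n : Fin r → ℤ) : Submodule R (FunctorSum h𝒜 hℳ F) :=
  LinearMap.range (of h𝒜 hℳ F n)

variable {h𝒜 hℳ F}

theorem hom_ext {P : Type*} [AddCommGroup P] [Module R P] {f g : FunctorSum h𝒜 hℳ F →ₗ[R] P}
    (h : ∀ n x, f (of h𝒜 hℳ F n x) = g (of h𝒜 hℳ F n x)) : f = g :=
  DirectSum.linearMap_ext R fun n => LinearMap.ext fun x => h n x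

/-- The linear map out of `F(M)` given by linear maps out of the summands. -/
noncomputable def desc {P : Type*} [AddCommGroup P] [Module R P]
    (f : ∀ n, F.obj (gradedPiece h𝒜 hℳ n) →ₗ[R] P) : FunctorSum h𝒜 hℳ F →ₗ[R] P :=
  DirectSum.toModule R (Fin r → ℤ) P f

theorem desc_of {P : Type*} [AddCommGroup P] [Module R P]
    (f : ∀ n, F.obj (gradedPiece h𝒜 hℳ n) →ₗ[R] P) (n : Fin r → ℤ)
    (x : F.obj (gradedPiece h𝒜 hℳ n)) : desc f (of h𝒜 hℳ F n x) = f n x :=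
  DirectSum.toModule_lof (M := fun n => F.obj (gradedPiece h𝒜 hℳ n)) R n x

theorem of_map_congr {n m m' : Fin r → ℤ} (hm : m = m') {s s' : S} (hs : s = s')
    (h : ∀ x ∈ ℳ n, s • x ∈ ℳ m) (h' : ∀ x ∈ ℳ n, s' • x ∈ ℳ m')
    (x : F.obj (gradedPiece h𝒜 hℳ n)) :
    of h𝒜 hℳ F m (F.map (gradedPieceMul h𝒜 hℳ s h) x) =
      of h𝒜 hℳ F m' (F.map (gradedPieceMul h𝒜 hℳ s' h') x) := by
  subst hm; subst hs; rfl

variable (h𝒜 hℳ F) [F.Additive] [F.Linear R]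

/-- For `s ∈ S_i`, the endomorphism of `F(M)` which on `F(M_n)` is the map
`F(M_n) ⟶ F(M_{i + n})` obtained by applying `F` to multiplication by `s`. -/
noncomputable def homogeneousAction (i : Fin r → ℕ) :
    𝒜 i →ₗ[R] Module.End R (FunctorSum h𝒜 hℳ F) where
  toFun a := desc fun n =>
    of h𝒜 hℳ F (natDeg i + n) ∘ₗ
      (F.map (gradedPieceMul h𝒜 hℳ (a : S) fun x hx => hℳ.smul_mem i n a x a.2 hx)).hom
  map_add' a b := by
    refine hom_ext fun n x => ?_
    have : gradedPieceMul h𝒜 hℳ ((a + b : 𝒜 i) : S)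
          (fun x hx => hℳ.smul_mem i n _ x (a + b).2 hx) =
        gradedPieceMul h𝒜 hℳ (a : S) (fun x hx => hℳ.smul_mem i n a x a.2 hx) +
          gradedPieceMul h𝒜 hℳ (b : S) (fun x hx => hℳ.smul_mem i n b x b.2 hx) := by
      ext y
      exact Subtype.ext (add_smul (a : S) (b : S) (y : ℳ n).1)
    rw [LinearMap.add_apply, desc_of, desc_of, desc_of, this, F.map_add]
    exact map_add (of h𝒜 hℳ F (natDeg i + n)) _ _
  map_smul' c a := by
    refine hom_ext fun n x => ?_
    have : gradedPieceMul h𝒜 hℳ ((c • a : 𝒜 i) : S)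
          (fun x hx => hℳ.smul_mem i n _ x (c • a).2 hx) =
        c • gradedPieceMul h𝒜 hℳ (a : S) (fun x hx => hℳ.smul_mem i n a x a.2 hx) := by
      ext y
      exact Subtype.ext (smul_assoc c (a : S) (y : ℳ n).1)
    rw [RingHom.id_apply, LinearMap.smul_apply, desc_of, desc_of, this, F.map_smul]
    exact map_smul (of h𝒜 hℳ F (natDeg i + n)) c _

theorem homogeneousAction_of (i : Fin r → ℕ) (a : 𝒜 i) (n : Fin r → ℤ)
    (x : F.obj (gradedPiece h𝒜 hℳ n)) :
    homogeneousAction h𝒜 hℳ F i a (of h𝒜 hℳ F n x) = of h𝒜 hℳ F (natDeg i + n)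
      (F.map (gradedPieceMul h𝒜 hℳ (a : S) fun x hx => hℳ.smul_mem i n a x a.2 hx) x) :=
  desc_of _ n x

/-- The action of an arbitrary element of `S` on `F(M)`: the sum of the actions of its homogeneous
components. -/
noncomputable def actionLinear : S →ₗ[R] Module.End R (FunctorSum h𝒜 hℳ F) :=
  DirectSum.toModule R (Fin r → ℕ) _ (homogeneousAction h𝒜 hℳ F) ∘ₗ
    (DirectSum.decomposeLinearEquiv 𝒜).toLinearMap

theorem actionLinear_of {i : Fin r → ℕ} {s : S} (hs : s ∈ 𝒜 i) (n : Fin r → ℤ)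
    (x : F.obj (gradedPiece h𝒜 hℳ n)) :
    actionLinear h𝒜 hℳ F s (of h𝒜 hℳ F n x) = of h𝒜 hℳ F (natDeg i + n)
      (F.map (gradedPieceMul h𝒜 hℳ s fun x hx => hℳ.smul_mem i n s x hs hx) x) := by
  have h : DirectSum.decompose 𝒜 s = DirectSum.lof R _ (fun i => 𝒜 i) i ⟨s, hs⟩ :=
    DirectSum.decompose_of_mem 𝒜 hs
  simp only [actionLinear, LinearMap.comp_apply, LinearEquiv.coe_coe,
    DirectSum.decomposeLinearEquiv_apply, h, DirectSum.toModule_lof]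
  exact homogeneousAction_of h𝒜 hℳ F i ⟨s, hs⟩ n x

/-- The `S`-algebra action on `F(M)`. -/
noncomputable def action : S →ₐ[R] Module.End R (FunctorSum h𝒜 hℳ F) :=
  AlgHom.ofLinearMap (actionLinear h𝒜 hℳ F)
    (by
      refine hom_ext fun n x => ?_
      rw [actionLinear_of h𝒜 hℳ F SetLike.GradedOne.one_mem,
        of_map_congr (m' := n) (s' := 1) (by simp [natDeg_zero]) rfl _
          (fun x hx => by simpa using hx)]
      have : gradedPieceMul h𝒜 hℳ (1 : S) (fun x (hx : x ∈ ℳ n) => by simpa using hx) =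
          𝟙 (gradedPiece h𝒜 hℳ n) := by
        ext y
        exact Subtype.ext (one_smul S (y : ℳ n).1)
      rw [this, F.map_id]
      rfl)
    (by
      intro s t
      induction s using DirectSum.Decomposition.inductionOn 𝒜 with
      | zero => simp
      | add a b ha hb => rw [add_mul, map_add, map_add, ha, hb, add_mul]
      | @homogeneous i a =>
        induction t using DirectSum.Decomposition.inductionOn 𝒜 with
        | zero => simp
        | add b c hb hc => rw [mul_add, map_add, map_add, hb, hc, mul_add]
        | @homogeneous j b =>
          refine hom_ext fun n x => ?_
          rw [Module.End.mul_apply, actionLinear_of h𝒜 hℳ F b.2, actionLinear_of h𝒜 hℳ F a.2,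
            actionLinear_of h𝒜 hℳ F (SetLike.GradedMul.mul_mem a.2 b.2)]
          have hm : natDeg (i + j) + n = natDeg i + (natDeg j + n) := by
            rw [natDeg_add, add_assoc]
          have hab : ∀ x ∈ ℳ n, ((a : S) * b) • x ∈ ℳ (natDeg i + (natDeg j + n)) := by
            intro x hx
            rw [mul_smul]
            exact hℳ.smul_mem _ _ _ _ a.2 (hℳ.smul_mem _ _ _ _ b.2 hx)
          rw [of_map_congr hm rfl _ hab]
          have : gradedPieceMul h𝒜 hℳ ((a : S) * b) hab =
              gradedPieceMul h𝒜 hℳ (b : S) (fun x hx => hℳ.smul_mem j n b x b.2 hx) ≫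
                gradedPieceMul h𝒜 hℳ (a : S)
                  (fun x hx => hℳ.smul_mem i (natDeg j + n) a x a.2 hx) := by
            ext y
            exact Subtype.ext (mul_smul (a : S) (b : S) (y : ℳ n).1)
          rw [this, F.map_comp]
          rfl)

/-- The `S`-module structure on `F(M)`. -/
noncomputable instance : Module S (FunctorSum h𝒜 hℳ F) :=
  Module.compHom (FunctorSum h𝒜 hℳ F) (action h𝒜 hℳ F).toRingHom

/-- A homogeneous element `s ∈ S_i` acts on `F(M_n)` as `F` of multiplication by `s`. -/
theorem smul_of {i : Fin r → ℕ} {s : S} (hs : s ∈ 𝒜 i) (n : Fin r → ℤ)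
    (x : F.obj (gradedPiece h𝒜 hℳ n)) :
    s • of h𝒜 hℳ F n x = of h𝒜 hℳ F (natDeg i + n)
      (F.map (gradedPieceMul h𝒜 hℳ s fun x hx => hℳ.smul_mem i n s x hs hx) x) :=
  actionLinear_of h𝒜 hℳ F hs n x

instance : IsScalarTower R S (FunctorSum h𝒜 hℳ F) where
  smul_assoc c s x := by
    change action h𝒜 hℳ F (c • s) x = c • action h𝒜 hℳ F s x
    rw [map_smul]; rfl

end FunctorSum

end Pieces

/-! The functor matters only for finite generation. It is a quotient of `Hom(L, -)`, and if `L` has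
`k` generators, evaluating at them embeds `⨁ Hom(L, M_n)` into `M^k`. The embedding is `S`-linear
and `S` is Noetherian, so `⨁ Hom(L, M_n)` is finitely generated, and so is its image `F(M)`. The
three asymptotic claims then concern the components of an arbitrary finitely generated multigraded
module, again called `M`.

The basic tool is that `M_{i+m} = S_i M_m` for all `i`, once `m` dominates the degrees of a finite
set of homogeneous generators (`exists_component_eq_span`). Applied to a graded submodule `A`, it
shows that an inclusion of `A_n` in a submodule `B` persists in all larger degrees, so its truth
value is eventually constant (`stabilizes_le`).

Associated primes: `p` is associated to `M_n` exactly when some `x ∈ M_n` is killed by `p` but by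
nothing outside `p`. This is the failure of such an inclusion, and only the finitely many primes of
`Ass_R M` have to be tested.

Grade: `J M_n = M_n` is again such an inclusion. If it fails for large `n`, then either `J` lies in
a stable associated prime and the grade is 0, or one `x ∈ J` is regular on all `M_n` with `n` large.
In the second case the grade drops by one on passing to `M / xM`, and Noetherian induction on an
ideal annihilating `M` finishes.

Length: kernel and cokernel of multiplication by some `s` of degree `e_k` compute the `k`-th partial
difference of the length function. Both are killed by `s`, so induction on the number of generators
of `S` acting nontrivially makes all partial differences eventually polynomial, hence also the
function itself. -/

set_option linter.unusedSectionVars false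

/-! ### Grade via `Ext`, prime avoidance, finiteness of associated primes. -/

section Grade

open RingTheory.Sequence
open scoped Pointwise

variable {R : Type u} [CommRing R]

theorem moduleGrade_congr (J : Ideal R) {N : Type*} {N' : Type*} [AddCommGroup N] [Module R N]
    [AddCommGroup N'] [Module R N'] (e : N ≃ₗ[R] N') : moduleGrade J N = moduleGrade J N' := by
  have h : J • (⊤ : Submodule R N) = ⊤ ↔ J • (⊤ : Submodule R N') = ⊤ := by
    rw [← (Submodule.map_injective_of_injective e.injective).eq_iff, Submodule.map_smul'',
      Submodule.map_top, LinearEquiv.range]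
  simp only [moduleGrade, h, e.isRegular_congr]

theorem moduleGrade_eq_top {J : Ideal R} {N : Type*} [AddCommGroup N] [Module R N]
    (h : J • (⊤ : Submodule R N) = ⊤) : moduleGrade J N = ⊤ := by
  rw [moduleGrade, if_pos h]

theorem moduleGrade_eq_zero {J : Ideal R} {N : Type*} [AddCommGroup N] [Module R N]
    (hJ : J • (⊤ : Submodule R N) ≠ ⊤) (h : ∀ x ∈ J, ¬ IsSMulRegular N x) :
    moduleGrade J N = 0 := by
  rw [moduleGrade, if_neg hJ, ← nonpos_iff_eq_zero]
  refine iSup₂_le fun l hl => ?_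
  match l, hl with
  | [], _ => simp
  | x :: l, hl => exact absurd ((isRegular_cons_iff N x l).1 hl.2).1 (h x (hl.1 x (by simp)))

theorem ideal_smul_top_quotSMulTop_eq_top_iff {J : Ideal R} {N : Type*} [AddCommGroup N]
    [Module R N] {x : R} (hx : x ∈ J) :
    J • (⊤ : Submodule R (QuotSMulTop x N)) = ⊤ ↔ J • (⊤ : Submodule R N) = ⊤ := by
  have hsurj := Submodule.mkQ_surjective (x • (⊤ : Submodule R N))
  rw [← (Submodule.comap_injective_of_surjective hsurj).eq_iff, Submodule.comap_top,
    Submodule.comap_smul_top_of_surjective J _ hsurj, Submodule.ker_mkQ,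
    ← Submodule.ideal_span_singleton_smul,
    sup_eq_left.2 (Submodule.smul_mono_left ((Ideal.span_singleton_le_iff_mem J).2 hx))]

/-- Rees's argument: a regular sequence of length `n` in `J` makes `Ext^i(R/J, N)` vanish for `i <
n`. The long exact sequence of `0 → N → N → N/xN → 0` then gives vanishing of `Ext^i(R/J, N/xN)` for
`i < n - 1`, which conversely produces a regular sequence of that length. The given sequence need
not begin with `x`. -/
theorem exists_isRegular_quotSMulTop [IsNoetherianRing R] {J : Ideal R} {N : Type u}
    [AddCommGroup N] [Module R N] [Module.Finite R N] (hJ : J • (⊤ : Submodule R N) ≠ ⊤) {x : R}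
    (hxJ : x ∈ J) (hx : IsSMulRegular N x) {l : List R} (hl : ∀ a ∈ l, a ∈ J)
    (hreg : IsRegular N l) :
    ∃ l' : List R, l'.length = l.length - 1 ∧ (∀ a ∈ l', a ∈ J) ∧
      IsRegular (QuotSMulTop x N) l' := by
  have hsupp : Module.support R (R ⧸ J) = PrimeSpectrum.zeroLocus J := by
    rw [Module.support_eq_zeroLocus, Ideal.annihilator_quotient]
  have hext := ModuleCat.subsingleton_ext_of_exists_isRegular J (ModuleCat.of R (R ⧸ J))
    hsupp.subset (ModuleCat.of R N) (lt_top_iff_ne_top.2 hJ) l hl hreg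
  refine ModuleCat.exists_isRegular_of_exists_subsingleton_ext J _
    (ModuleCat.of R (QuotSMulTop x N))
    (lt_top_iff_ne_top.2 fun h => hJ ((ideal_smul_top_quotSMulTop_eq_top_iff hxJ).1 h))
    (ModuleCat.of R (R ⧸ J)) hsupp fun i hi => ?_
  have zero1 := AddCommGrpCat.isZero_of_iff_subsingleton.mpr (hext i (by omega))
  have zero2 := AddCommGrpCat.isZero_of_iff_subsingleton.mpr (hext (i + 1) (by omega))
  have hx' : IsSMulRegular (ModuleCat.of R N) x := hx
  exact AddCommGrpCat.subsingleton_of_isZero <| ShortComplex.Exact.isZero_of_both_zeros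
    ((Abelian.Ext.covariant_sequence_exact₃' _ hx'.smulShortComplex_shortExact) i (i + 1) rfl)
    (zero1.eq_zero_of_src _) (zero2.eq_zero_of_tgt _)

theorem moduleGrade_eq_quotSMulTop_add_one [IsNoetherianRing R] {J : Ideal R} {N : Type u}
    [AddCommGroup N] [Module R N] [Module.Finite R N] (hJ : J • (⊤ : Submodule R N) ≠ ⊤) {x : R}
    (hxJ : x ∈ J) (hx : IsSMulRegular N x) :
    moduleGrade J N = moduleGrade J (QuotSMulTop x N) + 1 := by
  have hJ' : J • (⊤ : Submodule R (QuotSMulTop x N)) ≠ ⊤ :=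
    fun h => hJ ((ideal_smul_top_quotSMulTop_eq_top_iff hxJ).1 h)
  rw [moduleGrade, moduleGrade, if_neg hJ, if_neg hJ']
  apply le_antisymm
  · refine iSup₂_le fun l hl => ?_
    obtain ⟨l', h1, h2, h3⟩ := exists_isRegular_quotSMulTop hJ hxJ hx hl.1 hl.2
    refine le_trans ?_ (add_le_add_left (le_iSup₂_of_le l' ⟨h2, h3⟩ le_rfl) 1)
    rw [h1]
    norm_cast
    omega
  · have : Nonempty (List R) := ⟨[]⟩
    -- The empty sequence is regular because the quotient is nonzero; so the supremum has a nonempty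
    -- index set and the `+ 1` can be moved inside it.
    have hnil : IsRegular (QuotSMulTop x N) ([] : List R) := by
      have : Nontrivial (QuotSMulTop x N) := by
        by_contra h
        rw [not_nontrivial_iff_subsingleton] at h
        exact hJ' (Subsingleton.elim _ _)
      exact IsRegular.nil _ _
    rw [ENat.biSup_add' ⟨[], by simp, hnil⟩]
    refine iSup₂_le fun l hl => ?_
    refine le_iSup₂_of_le (x :: l) ⟨?_, (isRegular_cons_iff N x l).2 ⟨hx, hl.2⟩⟩ (by simp)
    simpa using ⟨hxJ, hl.1⟩

/-- Prime avoidance. The element depends only on the set of primes, so the same `x` serves all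
components of large degree at once. -/
theorem exists_regular_of_not_le_associatedPrimes [IsNoetherianRing R] {J : Ideal R}
    {A : Set (Ideal R)} (hA : A.Finite) (hprime : ∀ p ∈ A, p.IsPrime) (h : ∀ p ∈ A, ¬ J ≤ p) :
    ∃ x ∈ J, ∀ (N : Type u) [AddCommGroup N] [Module R N], associatedPrimes R N = A →
      IsSMulRegular N x := by
  have hnot : ¬ ((J : Set R) ⊆ ⋃ p ∈ A, (p : Set R)) := fun hsub =>
    -- Prime avoidance tolerates two non-prime ideals; here there are none, and `⊥` fills both
    -- places.
    have ⟨p, hp, hle⟩ := (Ideal.subset_union_prime_finite hA (f := id) ⊥ ⊥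
      (fun p hp _ _ => hprime p hp)).1 hsub
    h p hp hle
  obtain ⟨x, hxJ, hx⟩ := Set.not_subset.1 hnot
  refine ⟨x, hxJ, fun N _ _ hN => ?_⟩
  rw [← hN, biUnion_associatedPrimes_eq_compl_regular R N] at hx
  simpa using hx

theorem not_isSMulRegular_of_mem_associatedPrimes [IsNoetherianRing R] {p : Ideal R} {N : Type*}
    [AddCommGroup N] [Module R N] (hp : p ∈ associatedPrimes R N) {x : R} (hx : x ∈ p) :
    ¬ IsSMulRegular N x := by
  have : x ∈ ⋃ p ∈ associatedPrimes R N, (p : Set R) := Set.mem_biUnion hp hx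
  rw [biUnion_associatedPrimes_eq_compl_regular R N] at this
  simpa using this

/-- A finitely generated module over a Noetherian algebra has finitely many associated primes over
the base ring. -/
theorem associatedPrimes_finite_of_algebra {S : Type v} [CommRing S] [Algebra R S]
    [IsNoetherianRing S] [IsNoetherianRing R] (M : Type*) [AddCommGroup M] [Module R M]
    [Module S M] [IsScalarTower R S M] (hM : Module.Finite S M) :
    (associatedPrimes R M).Finite := by
  have key : ∀ [Module R M] [IsScalarTower R S M], (associatedPrimes R M).Finite := by
    induction hM using IsNoetherianRing.induction_on_isQuotientEquivQuotientPrime S with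
    | subsingleton N => intro _ _; simp [associatedPrimes.eq_empty_of_subsingleton]
    | quotient N p f =>
      intro _ _
      -- Every nonzero element of the domain `S / p` has annihilator `p ∩ R` in `R`, so that is the
      -- only possible associated prime.
      rw [LinearEquiv.AssociatedPrimes.eq (f.restrictScalars R)]
      refine (Set.finite_singleton (p.1.comap (algebraMap R S))).subset fun q hq => ?_
      rw [AssociatedPrimes.mem_iff, isAssociatedPrime_iff] at hq
      obtain ⟨hq, x, hx⟩ := hq
      have hx0 : x ≠ 0 := by
        rintro rfl
        exact hq.ne_top (by rw [hx]; simp)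
      obtain ⟨s, rfl⟩ := Ideal.Quotient.mk_surjective x
      have hs : s ∉ p.1 := fun h => hx0 (Ideal.Quotient.eq_zero_iff_mem.2 h)
      refine Set.mem_singleton_iff.2 (Ideal.ext fun a => ?_)
      rw [hx, Submodule.mem_colon_singleton, Submodule.mem_bot, Algebra.smul_def,
        IsScalarTower.algebraMap_apply R S (S ⧸ p.1), Ideal.Quotient.algebraMap_eq, ← map_mul,
        Ideal.Quotient.eq_zero_iff_mem, p.2.mul_mem_iff_mem_or_mem, Ideal.mem_comap]
      simp [hs]
    | exact N₁ N₂ N₃ f g hf _ hfg h₁ h₃ =>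
      intro _ _
      -- The induction over `S`-modules supplies the outer terms without an `R`-structure; they
      -- receive the one restricted along `R → S`.
      let : Module R N₁ := Module.compHom N₁ (algebraMap R S)
      let : Module R N₃ := Module.compHom N₃ (algebraMap R S)
      have : IsScalarTower R S N₁ := .of_algebraMap_smul fun _ _ => rfl
      have : IsScalarTower R S N₃ := .of_algebraMap_smul fun _ _ => rfl
      exact (h₁.union h₃).subset (associatedPrimes.subset_union_of_exact
        (f := f.restrictScalars R) (g := g.restrictScalars R) hf hfg)
  exact key

end Grade

/-! ### Multigraded modules and the associated primes of their components. -/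

section Multigraded

open DirectSum

/-- Independence holds because `p n` is the identity on the `n`-th summand and kills the sum of the
others. -/
theorem DirectSum.isInternal_of_projections {ι R Q : Type*} [DecidableEq ι] [Ring R]
    [AddCommGroup Q] [Module R Q] (𝒬 : ι → Submodule R Q) (p : ι → Q →ₗ[R] Q)
    (same : ∀ n, ∀ x ∈ 𝒬 n, p n x = x) (ne : ∀ n m, m ≠ n → ∀ x ∈ 𝒬 m, p n x = 0)
    (top : ⨆ n, 𝒬 n = ⊤) : DirectSum.IsInternal 𝒬 := by
  rw [DirectSum.isInternal_submodule_iff_iSupIndep_and_iSup_eq_top]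
  refine ⟨fun n => Submodule.disjoint_def.2 fun x hx hx' => ?_, top⟩
  have : ⨆ m, ⨆ (_ : m ≠ n), 𝒬 m ≤ LinearMap.ker (p n) :=
    iSup₂_le fun m hm y hy => ne n m hm y hy
  rw [← same n x hx]
  exact this hx'

variable {r : ℕ} {R : Type u} {S : Type v} {M : Type u} [CommRing R] [CommRing S] [Algebra R S]
  [AddCommGroup M] [Module R M] [Module S M] [IsScalarTower R S M]
  {𝒜 : (Fin r → ℕ) → Submodule R S} [GradedAlgebra 𝒜] {ℳ : (Fin r → ℤ) → Submodule R M}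

/-- Degrees lie in `ℕ^r`, so projection to degree 0 is a ring homomorphism, and `R ≅ S_0` is a
quotient of `S`. -/
theorem isNoetherianRing_of_isStandardGraded [IsNoetherianRing S] (h𝒜 : IsStandardGraded 𝒜) :
    IsNoetherianRing R := by
  have h0 : IsNoetherianRing (𝒜 0) :=
    isNoetherianRing_of_surjective S (𝒜 0) _ (GradedRing.projZeroRingHom'_surjective 𝒜)
  have hbij : Function.Bijective (algebraMap R (𝒜 0)) := by
    refine ⟨fun a b h => h𝒜.algebraMap_injective (congrArg Subtype.val h), fun s => ?_⟩
    obtain ⟨a, ha⟩ := h𝒜.degree_zero s s.2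
    exact ⟨a, Subtype.ext ha⟩
  exact isNoetherianRing_of_ringEquiv (𝒜 0) (RingEquiv.ofBijective _ hbij).symm

theorem algebraMap_mem_zero (a : R) : algebraMap R S a ∈ 𝒜 0 :=
  SetLike.algebraMap_mem_graded 𝒜 a

section Projection

variable (ℳ) [Decomposition ℳ]

/-- The projection of a graded module onto its component of degree `n`. -/
def gradedProj (n : Fin r → ℤ) : M →ₗ[R] M :=
  (ℳ n).subtype ∘ₗ DirectSum.component R _ (fun n => ℳ n) n ∘ₗ
    (decomposeLinearEquiv ℳ).toLinearMap

theorem gradedProj_mem (n : Fin r → ℤ) (x : M) : gradedProj ℳ n x ∈ ℳ n := (decompose ℳ x n).2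

theorem gradedProj_same {n : Fin r → ℤ} {x : M} (hx : x ∈ ℳ n) : gradedProj ℳ n x = x :=
  decompose_of_mem_same ℳ hx

theorem gradedProj_ne {n m : Fin r → ℤ} (h : m ≠ n) {x : M} (hx : x ∈ ℳ m) :
    gradedProj ℳ n x = 0 :=
  decompose_of_mem_ne ℳ hx h

theorem mem_of_gradedProj_mem (N : Submodule R M) (x : M) (h : ∀ n, gradedProj ℳ n x ∈ N) :
    x ∈ N := by
  classical
  rw [← sum_support_decompose ℳ x]
  exact N.sum_mem fun n _ => h n

theorem gradedProj_smul (hℳ : IsMultigradedModule 𝒜 ℳ) {i : Fin r → ℕ} {s : S} (hs : s ∈ 𝒜 i)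
    (n : Fin r → ℤ) (x : M) :
    gradedProj ℳ (natDeg i + n) (s • x) = s • gradedProj ℳ n x := by
  induction x using Decomposition.inductionOn ℳ with
  | zero => simp
  | add a b ha hb => rw [smul_add, map_add, map_add, smul_add, ha, hb]
  | @homogeneous m x =>
    have hx := hℳ.smul_mem i m s x hs x.2
    by_cases h : m = n
    · subst h
      rw [gradedProj_same ℳ hx, gradedProj_same ℳ x.2]
    · rw [gradedProj_ne ℳ (fun h' => h (add_left_cancel h')) hx, gradedProj_ne ℳ h x.2, smul_zero]

/-- A submodule is graded if it contains the homogeneous components of its elements. -/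
def IsGradedSubmodule (N : Submodule S M) : Prop := ∀ x ∈ N, ∀ n, gradedProj ℳ n x ∈ N

/-- The grading of a quotient module. -/
def quotientGrading (ℳ : (Fin r → ℤ) → Submodule R M) (N : Submodule S M) (n : Fin r → ℤ) :
    Submodule R (M ⧸ N) :=
  (ℳ n).map (N.mkQ.restrictScalars R)

/-- The grading of a submodule. -/
def submoduleGrading (ℳ : (Fin r → ℤ) → Submodule R M) (N : Submodule S M) (n : Fin r → ℤ) :
    Submodule R N :=
  (ℳ n).comap (N.subtype.restrictScalars R)

variable {ℳ}

theorem IsMultigradedModule.submodule (hℳ : IsMultigradedModule 𝒜 ℳ) {N : Submodule S M}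
    (hN : IsGradedSubmodule ℳ N) : IsMultigradedModule 𝒜 (submoduleGrading ℳ N) where
  isInternal := by
    let p (n : Fin r → ℤ) : N →ₗ[R] N :=
      (gradedProj ℳ n).restrict (p := N.restrictScalars R) (q := N.restrictScalars R)
        fun x hx => hN x hx n
    refine isInternal_of_projections _ p (fun n x hx => Subtype.ext (gradedProj_same ℳ hx))
      (fun n m h x hx => Subtype.ext (gradedProj_ne ℳ h hx)) (eq_top_iff.2 fun x _ => ?_)
    classical
    have hx : x = ∑ n ∈ (decompose ℳ (x : M)).support, p n x :=
      Subtype.ext (by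
        rw [AddSubmonoidClass.coe_finsetSum]
        exact (sum_support_decompose ℳ (x : M)).symm)
    rw [hx]
    exact Submodule.sum_mem _ fun n _ => Submodule.mem_iSup_of_mem n (gradedProj_mem ℳ n x)
  smul_mem i n s x hs hx := hℳ.smul_mem i n s x hs hx

theorem IsMultigradedModule.quotient (hℳ : IsMultigradedModule 𝒜 ℳ) {N : Submodule S M}
    (hN : IsGradedSubmodule ℳ N) : IsMultigradedModule 𝒜 (quotientGrading ℳ N) where
  isInternal := by
    let p (n : Fin r → ℤ) : (M ⧸ N) →ₗ[R] (M ⧸ N) :=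
      Submodule.mapQ (N.restrictScalars R) (N.restrictScalars R) (gradedProj ℳ n)
        fun x hx => hN x hx n
    refine isInternal_of_projections _ p ?_ ?_ (eq_top_iff.2 fun x _ => ?_)
    · rintro n _ ⟨x, hx, rfl⟩
      exact congrArg N.mkQ (gradedProj_same ℳ hx)
    · rintro n m h _ ⟨x, hx, rfl⟩
      exact congrArg N.mkQ (gradedProj_ne ℳ h hx) |>.trans (map_zero _)
    · obtain ⟨x, rfl⟩ := N.mkQ_surjective x
      refine mem_of_gradedProj_mem ℳ (Submodule.comap (N.mkQ.restrictScalars R)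
        (⨆ n, quotientGrading ℳ N n)) x fun n => ?_
      exact Submodule.mem_iSup_of_mem n ⟨_, gradedProj_mem ℳ n x, rfl⟩
  smul_mem i n s x hs hx := by
    obtain ⟨x, hx, rfl⟩ := hx
    exact ⟨s • x, hℳ.smul_mem i n s x hs hx, map_smul N.mkQ s x⟩

theorem isGradedSubmodule_ker (hℳ : IsMultigradedModule 𝒜 ℳ) {i : Fin r → ℕ} {s : S}
    (hs : s ∈ 𝒜 i) : IsGradedSubmodule ℳ (LinearMap.ker (LinearMap.lsmul S M s)) := by
  intro x hx n
  rw [LinearMap.mem_ker, LinearMap.lsmul_apply] at hx ⊢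
  rw [← gradedProj_smul ℳ hℳ hs, hx, map_zero]

theorem isGradedSubmodule_range (hℳ : IsMultigradedModule 𝒜 ℳ) {i : Fin r → ℕ} {s : S}
    (hs : s ∈ 𝒜 i) : IsGradedSubmodule ℳ (LinearMap.range (LinearMap.lsmul S M s)) := by
  rintro _ ⟨x, rfl⟩ n
  refine ⟨gradedProj ℳ (n - natDeg i) x, ?_⟩
  rw [LinearMap.lsmul_apply, LinearMap.lsmul_apply, ← gradedProj_smul ℳ hℳ hs,
    add_sub_cancel]

end Projection

/-- The products `B n = ∏ S_{e_k}^{n_k}` satisfy `B (i + j) = B i * B j` and `B n ≤ S_n`. Their sum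
is a subalgebra containing the generators, hence all of `S`; comparing degrees, `S_n ≤ B n`. -/
theorem IsStandardGraded.component_add_le (h𝒜 : IsStandardGraded 𝒜) (i j : Fin r → ℕ) :
    𝒜 (i + j) ≤ 𝒜 i * 𝒜 j := by
  let B (n : Fin r → ℕ) : Submodule R S := ∏ k, 𝒜 (Pi.single k 1) ^ n k
  have hB0 : B 0 = 1 := by simp [B]
  have hB (i j) : B (i + j) = B i * B j := by
    simp only [B, Pi.add_apply, pow_add, Finset.prod_mul_distrib]
  have hB1 (k : Fin r) : B (Pi.single k 1) = 𝒜 (Pi.single k 1) := by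
    simp only [B]
    rw [Finset.prod_eq_single k]
    · simp
    · intro l _ hl
      simp [Pi.single_eq_of_ne hl]
    · simp
  have hmul (i j) : 𝒜 i * 𝒜 j ≤ 𝒜 (i + j) :=
    Submodule.mul_le.2 fun a ha b hb => SetLike.GradedMul.mul_mem ha hb
  have hpow (k : Fin r) (m : ℕ) : 𝒜 (Pi.single k 1) ^ m ≤ 𝒜 (m • Pi.single k 1) := by
    induction m with
    | zero =>
      rw [pow_zero, zero_smul, Submodule.one_le]
      exact SetLike.GradedOne.one_mem
    | succ m ih =>
      rw [pow_succ, succ_nsmul]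
      exact (mul_le_mul' ih le_rfl).trans (hmul _ _)
  have hBle (n) : B n ≤ 𝒜 n := by
    have : ∀ T : Finset (Fin r),
        ∏ k ∈ T, 𝒜 (Pi.single k 1) ^ n k ≤ 𝒜 (∑ k ∈ T, n k • Pi.single k 1) := by
      intro T
      induction T using Finset.induction_on with
      | empty =>
        rw [Finset.prod_empty, Finset.sum_empty, Submodule.one_le]
        exact SetLike.GradedOne.one_mem
      | insert a T ha ih =>
        rw [Finset.prod_insert ha, Finset.sum_insert ha]
        exact (mul_le_mul' (hpow _ _) ih).trans (hmul _ _)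
    have hn : ∑ k, n k • (Pi.single k 1 : Fin r → ℕ) = n := by
      ext l
      simp [Finset.sum_apply, Pi.single_apply]
    have h := this Finset.univ
    rwa [hn] at h
  have key : ∀ s : S, ∀ n, (decompose 𝒜 s n : S) ∈ B n := by
    have hS : ∀ s ∈ ⨆ n, B n, ∀ n, (decompose 𝒜 s n : S) ∈ B n := by
      intro s hs n
      induction hs using Submodule.iSup_induction' with
      | mem m x hx =>
        by_cases h : m = n
        · subst h
          rwa [decompose_of_mem_same 𝒜 (hBle _ hx)]
        · rw [decompose_of_mem_ne 𝒜 (hBle _ hx) h]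
          exact zero_mem _
      | zero => simp
      | add x y _ _ hx hy =>
        rw [decompose_add, DirectSum.add_apply, Submodule.coe_add]
        exact add_mem hx hy
    intro s
    refine hS s ?_
    have hs : s ∈ Algebra.adjoin R (⋃ k : Fin r, (𝒜 (Pi.single k 1) : Set S)) := by
      rw [h𝒜.generated]; trivial
    have hone : (1 : S) ∈ B 0 := by rw [hB0]; exact Submodule.one_le.1 le_rfl
    induction hs using Algebra.adjoin_induction with
    | mem x hx =>
      obtain ⟨k, hk⟩ := Set.mem_iUnion.1 hx
      exact Submodule.mem_iSup_of_mem (Pi.single k 1) (by rw [hB1]; exact hk)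
    | algebraMap a =>
      rw [Algebra.algebraMap_eq_smul_one]
      exact Submodule.mem_iSup_of_mem 0 (Submodule.smul_mem _ _ hone)
    | add x y _ _ hx hy => exact add_mem hx hy
    | mul x y _ _ hx hy =>
      have hle : (⨆ n, B n) * ⨆ n, B n ≤ ⨆ n, B n := by
        simp only [Submodule.iSup_mul, Submodule.mul_iSup, iSup_le_iff, ← hB]
        exact fun i j => le_iSup B _
      exact hle (Submodule.mul_mem_mul hx hy)
  intro s hs
  have h := key s (i + j)
  rw [decompose_of_mem_same 𝒜 hs, hB] at h
  exact mul_le_mul' (hBle i) (hBle j) h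

/-- In large degrees a finitely generated graded module is generated by multiplication. -/
theorem IsMultigradedModule.exists_component_eq_span [IsNoetherianRing S] [Module.Finite S M]
    (h𝒜 : IsStandardGraded 𝒜) (hℳ : IsMultigradedModule 𝒜 ℳ) :
    ∃ c : Fin r → ℕ, ∀ m : Fin r → ℤ, natDeg c ≤ m → ∀ i : Fin r → ℕ, ∀ y ∈ ℳ (natDeg i + m),
      y ∈ Submodule.span R (Set.image2 (fun (s : S) (x : M) => s • x) (𝒜 i) (ℳ m)) := by
  let := hℳ.isInternal.chooseDecomposition
  have htop : Submodule.span S (⋃ n, (ℳ n : Set M)) = ⊤ := by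
    refine eq_top_iff.2 fun x _ => ?_
    refine mem_of_gradedProj_mem ℳ (Submodule.restrictScalars R (Submodule.span S _)) x fun n => ?_
    exact Submodule.subset_span (Set.mem_iUnion.2 ⟨n, gradedProj_mem ℳ n x⟩)
  have hfg : (Submodule.span S (⋃ n, (ℳ n : Set M))).FG := htop ▸ Module.Finite.fg_top
  obtain ⟨G, hG, hspan⟩ := (Submodule.fg_span_iff_fg_span_finset_subset _).1 hfg
  rw [htop] at hspan
  have hdeg : ∀ g ∈ G, ∃ d, g ∈ ℳ d := fun g hg => Set.mem_iUnion.1 (hG hg)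
  choose! d hd using hdeg
  -- `c` dominates the degrees of all the homogeneous generators.
  let c : Fin r → ℕ := fun k => G.sup fun g => (d g k).toNat
  have hc : ∀ g ∈ G, d g ≤ natDeg c := fun g hg k => by
    have : (d g k).toNat ≤ c k := Finset.le_sup (f := fun g => (d g k).toNat) hg
    simp only [natDeg]
    omega
  refine ⟨c, fun m hm i y hy => ?_⟩
  set T := Submodule.span R (Set.image2 (fun (s : S) (x : M) => s • x) (𝒜 i) (ℳ m)) with hT
  have hgen : ∀ g ∈ G, ∀ s : S, gradedProj ℳ (natDeg i + m) (s • g) ∈ T := by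
    intro g hg s
    induction s using Decomposition.inductionOn 𝒜 with
    | zero => simp
    | add a b ha hb => rw [add_smul, map_add]; exact add_mem ha hb
    | @homogeneous j s =>
      have hsg := hℳ.smul_mem j (d g) s g s.2 (hd g hg)
      by_cases h : natDeg j + d g = natDeg i + m
      -- From `j + d g = i + m` and `d g ≤ c ≤ m` follows `i ≤ j`, so `s` splits into products from
      -- `S_i` and `S_{j'}`, and the second factors carry `g` into `M_m`.
      · obtain ⟨j', rfl⟩ : ∃ j', j = i + j' := by
          refine ⟨j - i, ?_⟩
          ext k
          have h1 := congrFun h k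
          have h2 : d g k ≤ m k := (hc g hg).trans hm k
          simp only [natDeg, Pi.add_apply] at h1
          simp only [Pi.add_apply, Pi.sub_apply]
          omega
        have hm' : natDeg j' + d g = m := by
          rw [natDeg_add, add_assoc] at h
          exact add_left_cancel h
        rw [gradedProj_same ℳ (h ▸ hsg)]
        have hs := h𝒜.component_add_le i j' s.2
        refine Submodule.mul_induction_on (C := fun s => s • g ∈ T) hs (fun a ha b hb => ?_)
          fun a b ha hb => by rw [add_smul]; exact add_mem ha hb
        rw [mul_smul]
        exact Submodule.subset_span ⟨a, ha, b • g, hm' ▸ hℳ.smul_mem j' (d g) b g hb (hd g hg), rfl⟩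
      · rw [gradedProj_ne ℳ h hsg]
        exact zero_mem _
  have hall : ∀ z ∈ Submodule.span S (G : Set M), ∀ s : S,
      gradedProj ℳ (natDeg i + m) (s • z) ∈ T := by
    intro z hz
    induction hz using Submodule.span_induction with
    | mem z hz => exact hgen z hz
    | zero => intro s; simp
    | add a b _ _ ha hb => intro s; rw [smul_add, map_add]; exact add_mem (ha s) (hb s)
    | smul t z _ hz => intro s; rw [smul_smul]; exact hz _
  have := hall y (by rw [← hspan]; trivial) 1
  rwa [one_smul, gradedProj_same ℳ hy] at this

theorem exists_natDeg_add {n m : Fin r → ℤ} (h : m ≤ n) : ∃ i : Fin r → ℕ, natDeg i + m = n := by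
  refine ⟨fun k => (n k - m k).toNat, ?_⟩
  ext k
  have : m k ≤ n k := h k
  simp only [natDeg, Pi.add_apply]
  omega

theorem natDeg_mono {c d : Fin r → ℕ} (h : c ≤ d) : natDeg c ≤ natDeg d := fun k => by
  have : c k ≤ d k := h k
  simp only [natDeg]
  omega

theorem stabilizesAsymptotically_iff {X : Type*} {x : (Fin r → ℤ) → X} :
    StabilizesAsymptotically x ↔ ∃ (c : Fin r → ℕ) (a : X), ∀ n, natDeg c ≤ n → x n = a :=
  ⟨fun ⟨c, h⟩ => ⟨c, _, h⟩, fun ⟨c, _, h⟩ => ⟨c, fun n hn => (h n hn).trans (h _ le_rfl).symm⟩⟩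

/-- Whether a graded submodule `A` lies in a submodule `B` in degree `n` does not depend on
`n ≫ 0`. -/
theorem IsMultigradedModule.stabilizes_le [IsNoetherianRing S] [Module.Finite S M]
    [Decomposition ℳ] (h𝒜 : IsStandardGraded 𝒜) (hℳ : IsMultigradedModule 𝒜 ℳ)
    {A : Submodule S M} (hA : IsGradedSubmodule ℳ A) (B : Submodule S M) :
    StabilizesAsymptotically fun n : Fin r → ℤ => ∀ x ∈ ℳ n, x ∈ A → x ∈ B := by
  obtain ⟨c, hc⟩ := (hℳ.submodule hA).exists_component_eq_span h𝒜
  have up : ∀ m : Fin r → ℤ, natDeg c ≤ m → (∀ x ∈ ℳ m, x ∈ A → x ∈ B) →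
      ∀ n, m ≤ n → ∀ x ∈ ℳ n, x ∈ A → x ∈ B := by
    intro m hm h n hmn x hx hxA
    obtain ⟨i, rfl⟩ := exists_natDeg_add hmn
    have hle : Submodule.span R (Set.image2 (fun (s : S) (x : A) => s • x) (𝒜 i)
        (submoduleGrading ℳ A m)) ≤ (B.comap A.subtype).restrictScalars R := by
      rw [Submodule.span_le]
      rintro _ ⟨s, -, y, hy, rfl⟩
      exact B.smul_mem s (h y hy y.2)
    exact hle (hc m hm i ⟨x, hxA⟩ hx)
  rw [stabilizesAsymptotically_iff]
  -- Either the inclusion holds in one degree beyond `c`, hence in all degrees above that one, or it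
  -- fails everywhere beyond `c`.
  by_cases h : ∃ m : Fin r → ℤ, natDeg c ≤ m ∧ ∀ x ∈ ℳ m, x ∈ A → x ∈ B
  · obtain ⟨m, hm, h⟩ := h
    refine ⟨fun k => (m k).toNat, True, fun n hn => eq_true (up m hm h n (le_trans ?_ hn))⟩
    exact fun k => Int.self_le_toNat _
  · exact ⟨c, False, fun n hn => eq_false fun h' => h ⟨n, hn, h'⟩⟩

/-- With `A` the elements killed by `p` and `B` those killed by something outside `p`, the prime `p`
is associated to `M_n` exactly when `A_n` is not contained in `B`. -/
theorem IsMultigradedModule.stabilizes_associatedPrimes [IsNoetherianRing S]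
    [Module.Finite S M] (h𝒜 : IsStandardGraded 𝒜) (hℳ : IsMultigradedModule 𝒜 ℳ) :
    StabilizesAsymptotically fun n : Fin r → ℤ => associatedPrimes R (ℳ n) := by
  let := hℳ.isInternal.chooseDecomposition
  have := isNoetherianRing_of_isStandardGraded h𝒜
  have hfin := associatedPrimes_finite_of_algebra (R := R) (S := S) M inferInstance
  have hprime : ∀ p ∈ associatedPrimes R M,
      StabilizesAsymptotically fun n : Fin r → ℤ => p ∈ associatedPrimes R (ℳ n) := by
    intro p hp
    have hp' : p.IsPrime := hp.isPrime
    let A : Submodule S M :=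
      { carrier := {x | ∀ a ∈ p, a • x = 0}
        zero_mem' := fun a _ => smul_zero a
        add_mem' := fun hx hy a ha => by rw [smul_add, hx a ha, hy a ha, add_zero]
        smul_mem' := fun s x hx a ha => by rw [smul_comm, hx a ha, smul_zero] }
    let B : Submodule S M :=
      { carrier := {x | ∃ f ∉ p, f • x = 0}
        zero_mem' := ⟨1, p.one_notMem, smul_zero _⟩
        add_mem' := fun {x y} ⟨f, hf, hx⟩ ⟨g, hg, hy⟩ =>
          ⟨f * g, hp'.mul_notMem hf hg, by
            rw [smul_add, mul_smul f g y, hy, mul_comm, mul_smul, hx, smul_zero, smul_zero,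
              add_zero]⟩
        smul_mem' := fun s x ⟨f, hf, hx⟩ => ⟨f, hf, by rw [smul_comm, hx, smul_zero]⟩ }
    have hA : IsGradedSubmodule ℳ A := fun x hx n a ha => by
      rw [← map_smul, hx a ha, map_zero]
    obtain ⟨c, hc⟩ := hℳ.stabilizes_le h𝒜 hA B
    have heq : ∀ n, p ∈ associatedPrimes R (ℳ n) ↔ ¬ ∀ x ∈ ℳ n, x ∈ A → x ∈ B := by
      intro n
      rw [AssociatedPrimes.mem_iff, isAssociatedPrime_iff]
      push Not
      constructor
      · rintro ⟨-, x, hx⟩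
        refine ⟨x, x.2, fun a ha => ?_, ?_⟩
        · rw [hx, Submodule.mem_colon_singleton, Submodule.mem_bot] at ha
          exact congrArg Subtype.val ha
        · rintro ⟨f, hf, hfx⟩
          rw [hx, Submodule.mem_colon_singleton, Submodule.mem_bot] at hf
          exact hf (Subtype.ext hfx)
      · rintro ⟨x, hx, hxA, hxB⟩
        refine ⟨hp', ⟨x, hx⟩, Ideal.ext fun a => ?_⟩
        rw [Submodule.mem_colon_singleton, Submodule.mem_bot]
        refine ⟨fun ha => Subtype.ext (hxA a ha), fun ha => ?_⟩
        by_contra hap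
        exact hxB ⟨a, hap, congrArg Subtype.val ha⟩
    exact ⟨c, fun n hn => by simp only [heq, hc n hn]⟩
  choose! c hc using hprime
  -- A common bound for the finitely many primes in `Ass_R M`; no other prime is associated to any
  -- component.
  refine ⟨fun k => hfin.toFinset.sup fun p => c p k, fun n hn => Set.ext fun p => ?_⟩
  by_cases hp : p ∈ associatedPrimes R M
  · have hle : c p ≤ fun k => hfin.toFinset.sup fun p => c p k := fun k =>
      Finset.le_sup (f := fun p => c p k) (hfin.mem_toFinset.2 hp)
    have hle' := natDeg_mono hle
    exact ((hc p hp n (hle'.trans hn)).trans (hc p hp _ hle').symm).to_iff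
  · have hsub (m) : p ∉ associatedPrimes R (ℳ m) := fun h =>
      hp (associatedPrimes.subset_of_injective (ℳ m).injective_subtype h)
    simp only [hsub]

end Multigraded

/-! ### Components of quotients and stability of grade. -/

section QuotientPieces

open DirectSum
open scoped Pointwise

variable {r : ℕ} {R : Type u} {S : Type v} {M : Type u} [CommRing R] [CommRing S] [Algebra R S]
  [AddCommGroup M] [Module R M] [Module S M] [IsScalarTower R S M]
  {𝒜 : (Fin r → ℕ) → Submodule R S} [GradedAlgebra 𝒜] {ℳ : (Fin r → ℤ) → Submodule R M}

/-- Multiplication by `s` as a map between components. -/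
def componentMul (s : S) {n m : Fin r → ℤ} (h : ∀ x ∈ ℳ n, s • x ∈ ℳ m) : ℳ n →ₗ[R] ℳ m :=
  (Algebra.lsmul R R M s).restrict h

/-- The projection from a component of `M` to the corresponding component of a quotient. -/
def componentMkQ (ℳ : (Fin r → ℤ) → Submodule R M) (N : Submodule S M) (n : Fin r → ℤ) :
    ℳ n →ₗ[R] quotientGrading ℳ N n :=
  (N.mkQ.restrictScalars R).restrict fun x hx => ⟨x, hx, rfl⟩

theorem componentMkQ_surjective (N : Submodule S M) (n : Fin r → ℤ) :
    Function.Surjective (componentMkQ ℳ N n) := by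
  rintro ⟨_, x, hx, rfl⟩
  exact ⟨⟨x, hx⟩, rfl⟩

theorem componentMkQ_eq_zero_iff (N : Submodule S M) (n : Fin r → ℤ) (x : ℳ n) :
    componentMkQ ℳ N n x = 0 ↔ (x : M) ∈ N := by
  rw [← Submodule.Quotient.mk_eq_zero N, ← Submodule.coe_eq_zero]
  rfl

theorem exact_componentMul_componentMkQ (hℳ : IsMultigradedModule 𝒜 ℳ) {i : Fin r → ℕ} {s : S}
    (hs : s ∈ 𝒜 i) {n m : Fin r → ℤ} (hm : natDeg i + n = m) (h : ∀ x ∈ ℳ n, s • x ∈ ℳ m) :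
    Function.Exact (componentMul (ℳ := ℳ) s h)
      (componentMkQ ℳ (LinearMap.range (LinearMap.lsmul S M s)) m) := by
  let := hℳ.isInternal.chooseDecomposition
  subst hm
  intro y
  rw [componentMkQ_eq_zero_iff]
  constructor
  · rintro ⟨x, hx⟩
    refine ⟨⟨gradedProj ℳ n x, gradedProj_mem ℳ n x⟩, Subtype.ext ?_⟩
    change s • gradedProj ℳ n x = y
    rw [← gradedProj_smul ℳ hℳ hs, ← LinearMap.lsmul_apply, hx, gradedProj_same ℳ y.2]
  · rintro ⟨x, rfl⟩
    exact ⟨x, rfl⟩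

/-- The components of `M / a M` are those of `M` modulo `a`. -/
theorem nonempty_component_quotient_equiv (hℳ : IsMultigradedModule 𝒜 ℳ) (a : R)
    (n : Fin r → ℤ) :
    Nonempty (QuotSMulTop a (ℳ n) ≃ₗ[R]
      quotientGrading ℳ (LinearMap.range (LinearMap.lsmul S M (algebraMap R S a))) n) := by
  have h : ∀ x ∈ ℳ n, algebraMap R S a • x ∈ ℳ n := fun x hx => by
    rw [algebraMap_smul]; exact (ℳ n).smul_mem a hx
  have hex := exact_componentMul_componentMkQ hℳ (algebraMap_mem_zero (𝒜 := 𝒜) a)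
    (m := n) (n := n) (by rw [natDeg_zero, zero_add]) h
  have hker : a • (⊤ : Submodule R (ℳ n)) = LinearMap.ker (componentMkQ ℳ
      (LinearMap.range (LinearMap.lsmul S M (algebraMap R S a))) n) := by
    rw [LinearMap.exact_iff.1 hex]
    ext x
    rw [Submodule.mem_smul_pointwise_iff_exists]
    constructor
    · rintro ⟨y, -, rfl⟩
      exact ⟨y, Subtype.ext (algebraMap_smul S a (y : M))⟩
    · rintro ⟨y, rfl⟩
      exact ⟨y, trivial, Subtype.ext (algebraMap_smul S a (y : M)).symm⟩
  exact ⟨(Submodule.quotEquivOfEq _ _ hker).trans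
    (LinearMap.quotKerEquivOfSurjective _ (componentMkQ_surjective _ n))⟩

/-- `J M` is an `S`-submodule whose degree `n` part is `J M_n`, so the condition says that `M_n`
lies in `J M`. -/
theorem IsMultigradedModule.stabilizes_smul_top_eq_top [IsNoetherianRing S] [Module.Finite S M]
    (h𝒜 : IsStandardGraded 𝒜) (hℳ : IsMultigradedModule 𝒜 ℳ) (J : Ideal R) :
    StabilizesAsymptotically fun n : Fin r → ℤ => J • (⊤ : Submodule R (ℳ n)) = ⊤ := by
  let := hℳ.isInternal.chooseDecomposition
  let B : Submodule S M :=
    { (J • (⊤ : Submodule R M) : Submodule R M) with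
      smul_mem' := fun s x hx => by
        have : J • (⊤ : Submodule R M) ≤
            (J • (⊤ : Submodule R M)).comap (Algebra.lsmul R R M s) := by
          rw [Submodule.smul_le]
          intro a ha y _
          rw [Submodule.mem_comap, map_smul]
          exact Submodule.smul_mem_smul ha trivial
        exact this hx }
  have key (n) : J • (⊤ : Submodule R (ℳ n)) = ⊤ ↔
      ∀ x ∈ ℳ n, x ∈ (⊤ : Submodule S M) → x ∈ B := by
    constructor
    · intro h x hx _
      have hle : (J • (⊤ : Submodule R (ℳ n))).map (ℳ n).subtype ≤ J • (⊤ : Submodule R M) := by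
        rw [Submodule.map_smul'']
        exact Submodule.smul_mono le_rfl le_top
      exact hle ⟨⟨x, hx⟩, by rw [h]; trivial, rfl⟩
    · intro h
      refine eq_top_iff.2 fun x _ => ?_
      let p : M →ₗ[R] ℳ n := (gradedProj ℳ n).codRestrict (ℳ n) (gradedProj_mem ℳ n)
      have hp : p x = x := Subtype.ext (gradedProj_same ℳ x.2)
      have hle : (J • (⊤ : Submodule R M)).map p ≤ J • ⊤ := by
        rw [Submodule.map_smul'']
        exact Submodule.smul_mono le_rfl le_top
      rw [← hp]
      exact hle ⟨x, h x x.2 trivial, rfl⟩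
  obtain ⟨c, hc⟩ := hℳ.stabilizes_le h𝒜 (A := ⊤) (fun _ _ _ => trivial) B
  exact ⟨c, fun n hn => by simp only [key, hc n hn]⟩

/-- The auxiliary ideal `I`, which annihilates `M`, is what the Noetherian induction runs on:
replacing `M` by `M / xM` enlarges `I` to `I + (x)`. -/
theorem IsMultigradedModule.stabilizes_moduleGrade_of_annihilated [IsNoetherianRing S]
    (h𝒜 : IsStandardGraded 𝒜) (J I : Ideal R) :
    ∀ (M : Type u) [AddCommGroup M] [Module R M] [Module S M] [IsScalarTower R S M]
      [Module.Finite S M] (ℳ : (Fin r → ℤ) → Submodule R M), IsMultigradedModule 𝒜 ℳ →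
      (∀ a ∈ I, ∀ x : M, a • x = 0) →
      StabilizesAsymptotically fun n : Fin r → ℤ => moduleGrade J (ℳ n) := by
  have := isNoetherianRing_of_isStandardGraded h𝒜
  induction I using WellFoundedGT.induction with
  | _ I ih =>
  intro M _ _ _ _ _ ℳ hℳ hI
  let := hℳ.isInternal.chooseDecomposition
  rw [stabilizesAsymptotically_iff]
  obtain ⟨c, hc⟩ := hℳ.stabilizes_smul_top_eq_top h𝒜 J
  by_cases hJ : J • (⊤ : Submodule R (ℳ (natDeg c))) = ⊤
  · exact ⟨c, ⊤, fun n hn => moduleGrade_eq_top ((hc n hn).to_iff.2 hJ)⟩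
  have hJ' (n) (hn : natDeg c ≤ n) : J • (⊤ : Submodule R (ℳ n)) ≠ ⊤ := fun h =>
    hJ ((hc n hn).to_iff.1 h)
  obtain ⟨d, hd⟩ := hℳ.stabilizes_associatedPrimes h𝒜
  have hcd : natDeg c ≤ natDeg (c ⊔ d) := natDeg_mono le_sup_left
  have hdc : natDeg d ≤ natDeg (c ⊔ d) := natDeg_mono le_sup_right
  by_cases hle : ∃ p ∈ associatedPrimes R (ℳ (natDeg d)), J ≤ p
  · obtain ⟨p, hp, hJp⟩ := hle
    refine ⟨c ⊔ d, 0, fun n hn => moduleGrade_eq_zero (hJ' n (hcd.trans hn)) fun x hx => ?_⟩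
    exact not_isSMulRegular_of_mem_associatedPrimes ((hd n (hdc.trans hn)).ge hp) (hJp hx)
  · push Not at hle
    have hfin := gradedPiece_finite h𝒜 hℳ
    obtain ⟨x, hxJ, hx⟩ := exists_regular_of_not_le_associatedPrimes
      (associatedPrimes.finite R (ℳ (natDeg d))) (fun p hp => hp.isPrime) hle
    have hreg (n) (hn : natDeg d ≤ n) : IsSMulRegular (ℳ n) x := hx (ℳ n) (hd n hn)
    -- An `x ∈ I` would act both injectively and as zero, forcing the component to vanish against `J
    -- M_n ≠ M_n`. Hence the enlargement of `I` is strict.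
    have hxI : x ∉ I := by
      intro hxI
      refine hJ' _ hcd ?_
      have : Subsingleton (ℳ (natDeg (c ⊔ d))) :=
        ⟨fun y z => hreg _ hdc (Subtype.ext (by
          simp only [Submodule.coe_smul, hI x hxI]))⟩
      exact Subsingleton.elim _ _
    set N := LinearMap.range (LinearMap.lsmul S M (algebraMap R S x)) with hN
    have hgr := isGradedSubmodule_range hℳ (algebraMap_mem_zero (𝒜 := 𝒜) x)
    obtain ⟨e, a, he⟩ := stabilizesAsymptotically_iff.1 <|
      ih (I ⊔ Ideal.span {x}) (left_lt_sup.2 fun h => hxI (h (Ideal.mem_span_singleton_self x)))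
        (M ⧸ N) (quotientGrading ℳ N) (hℳ.quotient hgr) (by
          intro b hb y
          obtain ⟨y, rfl⟩ := N.mkQ_surjective y
          have hle : I ⊔ Ideal.span {x} ≤ Submodule.comap
              (LinearMap.toSpanSingleton R M y) (N.restrictScalars R) := by
            refine sup_le (fun b hb => ?_) ?_
            · rw [Submodule.mem_comap, LinearMap.toSpanSingleton_apply, hI b hb]
              exact zero_mem _
            · rw [Ideal.span_singleton_le_iff_mem]
              exact ⟨y, algebraMap_smul S x y⟩
          exact (Submodule.Quotient.mk_eq_zero N).2 (hle hb))
    refine ⟨c ⊔ d ⊔ e, a + 1, fun n hn => ?_⟩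
    have hn' : natDeg (c ⊔ d) ≤ n := (natDeg_mono le_sup_left).trans hn
    have hne : natDeg e ≤ n := (natDeg_mono le_sup_right).trans hn
    obtain ⟨f⟩ := nonempty_component_quotient_equiv hℳ x n
    rw [moduleGrade_eq_quotSMulTop_add_one (hJ' n (hcd.trans hn')) hxJ (hreg n (hdc.trans hn')),
      moduleGrade_congr J f, he n hne]

theorem IsMultigradedModule.stabilizes_moduleGrade [IsNoetherianRing S] [Module.Finite S M]
    (h𝒜 : IsStandardGraded 𝒜) (hℳ : IsMultigradedModule 𝒜 ℳ) (J : Ideal R) :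
    StabilizesAsymptotically fun n : Fin r → ℤ => moduleGrade J (ℳ n) :=
  IsMultigradedModule.stabilizes_moduleGrade_of_annihilated h𝒜 J ⊥ M ℳ hℳ fun a ha x => by
    rw [Ideal.mem_bot.1 ha, zero_smul]

end QuotientPieces

/-! ### Eventually polynomial functions of several integers. -/

section EventuallyPolynomial

variable {r : ℕ}

/-- `f` agrees with a polynomial for all `n ≫ 0`. -/
def IsEventuallyPolynomial (f : (Fin r → ℤ) → ℚ) : Prop :=
  ∃ (P : MvPolynomial (Fin r) ℚ) (c : Fin r → ℕ), ∀ n : Fin r → ℤ, natDeg c ≤ n →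
    f n = MvPolynomial.eval (fun k => (n k : ℚ)) P

theorem MvPolynomial.eval_bind₁ {σ τ A : Type*} [CommSemiring A] (x : τ → A)
    (g : σ → MvPolynomial τ A) (P : MvPolynomial σ A) :
    eval x (bind₁ g P) = eval (fun j => eval x (g j)) P :=
  eval₂Hom_bind₁ _ _ _ _

theorem IsEventuallyPolynomial.sub {f g : (Fin r → ℤ) → ℚ} (hf : IsEventuallyPolynomial f)
    (hg : IsEventuallyPolynomial g) : IsEventuallyPolynomial fun n => f n - g n := by
  obtain ⟨P, c, hP⟩ := hf
  obtain ⟨Q, d, hQ⟩ := hg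
  refine ⟨P - Q, c ⊔ d, fun n hn => ?_⟩
  simp only [map_sub, hP n ((natDeg_mono le_sup_left).trans hn),
    hQ n ((natDeg_mono le_sup_right).trans hn)]

theorem IsEventuallyPolynomial.comp_add {f : (Fin r → ℤ) → ℚ} (hf : IsEventuallyPolynomial f)
    (i : Fin r → ℕ) : IsEventuallyPolynomial fun n => f (natDeg i + n) := by
  obtain ⟨P, c, hP⟩ := hf
  refine ⟨MvPolynomial.bind₁ (fun k => MvPolynomial.C (i k : ℚ) + MvPolynomial.X k) P, c,
    fun n hn => ?_⟩
  have hle : natDeg c ≤ natDeg i + n := hn.trans fun k => by simp [natDeg]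
  simp [hP _ hle, MvPolynomial.eval_bind₁, natDeg]

/-- For a monomial, use `B_{m+1}(1 + t) - B_{m+1}(t) = (m + 1) t^m` for Bernoulli polynomials in the
variable `k`; the other variables are constants for this difference. -/
theorem exists_antidifference (k : Fin r) (Q : MvPolynomial (Fin r) ℚ) :
    ∃ T : MvPolynomial (Fin r) ℚ, ∀ n : Fin r → ℤ,
      MvPolynomial.eval (fun j => ((natDeg (Pi.single k 1) + n) j : ℚ)) T =
        MvPolynomial.eval (fun j => (n j : ℚ)) T + MvPolynomial.eval (fun j => (n j : ℚ)) Q := by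
  induction Q using MvPolynomial.induction_on' with
  | add p q hp hq =>
    obtain ⟨T, hT⟩ := hp
    obtain ⟨U, hU⟩ := hq
    exact ⟨T + U, fun n => by simp only [map_add, hT, hU]; ring⟩
  | monomial s a =>
    let U : Polynomial ℚ := Polynomial.C ((s k + 1 : ℚ)⁻¹) * Polynomial.bernoulli (s k + 1)
    have hU (t : ℚ) : U.eval (1 + t) = U.eval t + t ^ s k := by
      have h : (s k + 1 : ℚ) ≠ 0 := by positivity
      simp only [U, Polynomial.eval_mul, Polynomial.eval_C, Polynomial.bernoulli_eval_one_add]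
      push_cast
      field_simp
    refine ⟨MvPolynomial.C a * Polynomial.aeval (MvPolynomial.X k) U *
      ∏ j ∈ Finset.univ.erase k, MvPolynomial.X j ^ s j, fun n => ?_⟩
    have hev (x : Fin r → ℚ) :
        MvPolynomial.eval x (Polynomial.aeval (MvPolynomial.X k) U) = U.eval (x k) := by
      rw [← MvPolynomial.coe_aeval_eq_eval, RingHom.coe_coe, ← Polynomial.aeval_algHom_apply,
        MvPolynomial.aeval_X, Polynomial.coe_aeval_eq_eval]
    have hprod : ∏ j ∈ Finset.univ.erase k, ((natDeg (Pi.single k 1) + n) j : ℚ) ^ s j =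
        ∏ j ∈ Finset.univ.erase k, (n j : ℚ) ^ s j :=
      Finset.prod_congr rfl fun j hj => by
        simp [natDeg, Pi.single_eq_of_ne (Finset.ne_of_mem_erase hj)]
    have hk : ((natDeg (Pi.single k 1) + n) k : ℚ) = 1 + n k := by simp [natDeg]
    simp only [map_mul, MvPolynomial.eval_C, map_prod, map_pow, MvPolynomial.eval_X, hev, hprod,
      hk, hU, MvPolynomial.eval_monomial]
    rw [Finsupp.prod_fintype _ _ (by simp), ← Finset.mul_prod_erase Finset.univ _
      (Finset.mem_univ k)]
    ring

theorem eq_update_of_forall_add_eq (k : Fin r) (c : Fin r → ℕ) {h : (Fin r → ℤ) → ℚ}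
    (hh : ∀ n, natDeg c ≤ n → h (natDeg (Pi.single k 1) + n) = h n) {n : Fin r → ℤ}
    (hn : natDeg c ≤ n) : h n = h (Function.update n k (c k)) := by
  have key : ∀ t : ℕ, h (Function.update n k (c k + t)) = h (Function.update n k (c k)) := by
    intro t
    induction t with
    | zero => simp
    | succ t ih =>
      rw [← ih, ← hh (Function.update n k (c k + t))]
      · congr 1
        ext j
        by_cases hj : j = k
        · subst hj
          simp [natDeg]
          ring
        · simp [natDeg, Function.update_of_ne hj, Pi.single_eq_of_ne hj]
      · intro j
        by_cases hj : j = k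
        · subst hj
          simp [natDeg]
        · rw [Function.update_of_ne hj]
          exact hn j
  have hnk : (c k : ℤ) ≤ n k := hn k
  rw [← key (n k - c k).toNat, Int.toNat_of_nonneg (by omega), add_sub_cancel,
    Function.update_eq_self]

/-- A function of several integers is eventually polynomial if all its partial differences are. -/
theorem IsEventuallyPolynomial.of_differences {f : (Fin r → ℤ) → ℚ}
    (hf : ∀ k : Fin r, IsEventuallyPolynomial fun n => f (natDeg (Pi.single k 1) + n) - f n) :
    IsEventuallyPolynomial f := by
  choose Q d hQ using hf
  let c : Fin r → ℕ := Finset.univ.sup d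
  have hc (k) (n : Fin r → ℤ) (hn : natDeg c ≤ n) : natDeg (d k) ≤ n :=
    (natDeg_mono (Finset.le_sup (Finset.mem_univ k))).trans hn
  choose T hT using fun k => exists_antidifference k (Q k)
  -- Beyond `c`, `f - T k` is invariant under shifts in direction `k`, so its `k`-th coordinate can
  -- be lowered to `c k`.
  have step (k) (n : Fin r → ℤ) (hn : natDeg c ≤ n) :
      f n = MvPolynomial.eval (fun j => (n j : ℚ)) (T k) -
        MvPolynomial.eval (fun j => (Function.update n k (c k : ℤ) j : ℚ)) (T k) +
        f (Function.update n k (c k)) := by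
    have := eq_update_of_forall_add_eq k c
      (h := fun n => f n - MvPolynomial.eval (fun j => (n j : ℚ)) (T k)) (fun n hn => by
        have := hQ k n (hc k n hn)
        simp only [hT]
        linarith) hn
    linarith
  -- The coordinates are frozen at `c` one by one, each at the cost of a polynomial; when all are
  -- frozen only the constant `f c` remains.
  have main : ∀ K : Finset (Fin r), ∃ P : MvPolynomial (Fin r) ℚ, ∀ n : Fin r → ℤ,
      natDeg c ≤ n → f n = MvPolynomial.eval (fun j => (n j : ℚ)) P +
        f (fun j => if j ∈ K then (c j : ℤ) else n j) := by
    intro K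
    induction K using Finset.induction_on with
    | empty => exact ⟨0, fun n _ => by simp⟩
    | insert k K hk ih =>
      obtain ⟨P, hP⟩ := ih
      let σ (K : Finset (Fin r)) : MvPolynomial (Fin r) ℚ →ₐ[ℚ] MvPolynomial (Fin r) ℚ :=
        MvPolynomial.bind₁ fun j => if j ∈ K then MvPolynomial.C (c j : ℚ) else MvPolynomial.X j
      have hσ (K : Finset (Fin r)) (n : Fin r → ℤ) (U) :
          MvPolynomial.eval (fun j => (n j : ℚ)) (σ K U) =
            MvPolynomial.eval (fun j => ((if j ∈ K then (c j : ℤ) else n j : ℤ) : ℚ)) U := by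
        rw [MvPolynomial.eval_bind₁]
        congr 2
        ext j
        split_ifs <;> simp
      refine ⟨P + (σ K (T k) - σ (insert k K) (T k)), fun n hn => ?_⟩
      have hle : natDeg c ≤ fun j => if j ∈ K then (c j : ℤ) else n j := fun j => by
        dsimp only
        split_ifs
        · exact le_rfl
        · exact hn j
      have hupd : Function.update (fun j => if j ∈ K then (c j : ℤ) else n j) k (c k : ℤ) =
          fun j => if j ∈ insert k K then (c j : ℤ) else n j := by
        ext j
        by_cases hj : j = k
        · subst hj
          simp
        · simp [Finset.mem_insert, hj]
      rw [hP n hn, step k _ hle, hupd, map_add, map_sub, hσ, hσ]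
      ring
  obtain ⟨P, hP⟩ := main Finset.univ
  refine ⟨P + MvPolynomial.C (f fun j => (c j : ℤ)), c, fun n hn => ?_⟩
  rw [hP n hn]
  simp

end EventuallyPolynomial

/-! ### Hilbert polynomials. -/

section Hilbert

open DirectSum

variable {r : ℕ} {R : Type u} {S : Type v} {M : Type u} [CommRing R] [CommRing S] [Algebra R S]
  [AddCommGroup M] [Module R M] [Module S M] [IsScalarTower R S M]
  {𝒜 : (Fin r → ℕ) → Submodule R S} [GradedAlgebra 𝒜] {ℳ : (Fin r → ℤ) → Submodule R M}

/-- The kernel of multiplication on a component is the component of the kernel. -/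
def kerComponentMulEquiv (s : S) {n m : Fin r → ℤ} (h : ∀ x ∈ ℳ n, s • x ∈ ℳ m) :
    submoduleGrading ℳ (LinearMap.ker (LinearMap.lsmul S M s)) n ≃ₗ[R]
      LinearMap.ker (componentMul (ℳ := ℳ) s h) where
  toFun x := ⟨⟨x.1.1, x.2⟩, Subtype.ext (LinearMap.mem_ker.1 x.1.2)⟩
  invFun x := ⟨⟨x.1.1, congrArg Subtype.val (LinearMap.mem_ker.1 x.2)⟩, x.1.2⟩
  map_add' _ _ := rfl
  map_smul' _ _ := rfl

/-- `l` is the length of the image of `s : M_n → M_{i+n}`. It cancels in the difference of the two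
lengths; two sums avoid subtracting in `ℕ∞`. -/
theorem length_component_add (hℳ : IsMultigradedModule 𝒜 ℳ) {i : Fin r → ℕ} {s : S}
    (hs : s ∈ 𝒜 i) (n : Fin r → ℤ) :
    ∃ l : ℕ∞,
      Module.length R (ℳ n) =
        Module.length R (submoduleGrading ℳ (LinearMap.ker (LinearMap.lsmul S M s)) n) + l ∧
      Module.length R (ℳ (natDeg i + n)) =
        l + Module.length R
          (quotientGrading ℳ (LinearMap.range (LinearMap.lsmul S M s)) (natDeg i + n)) := by
  have h : ∀ x ∈ ℳ n, s • x ∈ ℳ (natDeg i + n) := fun x hx => hℳ.smul_mem i n s x hs hx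
  let f := componentMul (ℳ := ℳ) s h
  refine ⟨Module.length R (LinearMap.range f), ?_, ?_⟩
  · rw [(kerComponentMulEquiv s h).length_eq]
    refine Module.length_eq_add_of_exact (LinearMap.ker f).subtype f.rangeRestrict
      (Submodule.injective_subtype _) f.surjective_rangeRestrict fun x => ?_
    rw [← LinearMap.coe_range, SetLike.mem_coe, Submodule.range_subtype, LinearMap.mem_ker]
    exact Subtype.ext_iff
  · refine Module.length_eq_add_of_exact (LinearMap.range f).subtype (componentMkQ ℳ _ _)
      (Submodule.injective_subtype _) (componentMkQ_surjective _ _) ?_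
    rw [LinearMap.exact_iff, Submodule.range_subtype, ← LinearMap.exact_iff]
    exact exact_componentMul_componentMkQ hℳ hs rfl h

theorem exists_finset_generating_degree [IsNoetherianRing S]
    (𝒜 : (Fin r → ℕ) → Submodule R S) (i : Fin r → ℕ) :
    ∃ X : Finset S, (X : Set S) ⊆ 𝒜 i ∧ ∀ s ∈ 𝒜 i, s ∈ Ideal.span (X : Set S) := by
  obtain ⟨X, hX, h⟩ := (Submodule.fg_span_iff_fg_span_finset_subset (R := S) (𝒜 i : Set S)).1
    (IsNoetherian.noetherian _)
  refine ⟨X, hX, fun s hs => ?_⟩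
  have : s ∈ Submodule.span S (𝒜 i : Set S) := Submodule.subset_span hs
  rwa [h] at this

/-- `d` bounds the number of chosen generators that act nontrivially on `M`. An `s` acting
nontrivially acts as zero on its own kernel and cokernel, so both fall under the induction
hypothesis. -/
theorem IsMultigradedModule.length_isEventuallyPolynomial_of_card [IsNoetherianRing S]
    (h𝒜 : IsStandardGraded 𝒜) (X : Fin r → Finset S)
    (hX : ∀ k, (X k : Set S) ⊆ 𝒜 (Pi.single k 1))
    (hspan : ∀ k, ∀ s ∈ 𝒜 (Pi.single k 1), s ∈ Ideal.span (X k : Set S)) (d : ℕ) :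
    ∀ (M : Type u) [AddCommGroup M] [Module R M] [Module S M] [IsScalarTower R S M]
      [Module.Finite S M] (ℳ : (Fin r → ℤ) → Submodule R M), IsMultigradedModule 𝒜 ℳ →
      (∃ c : Fin r → ℕ, ∀ n : Fin r → ℤ, natDeg c ≤ n → Module.length R (ℳ n) ≠ ⊤) →
      Set.ncard {s : S | (∃ k, s ∈ X k) ∧ ∃ x : M, s • x ≠ 0} ≤ d →
      IsEventuallyPolynomial fun n => ((Module.length R (ℳ n)).toNat : ℚ) := by
  induction d using Nat.strong_induction_on with
  | _ d ih =>
  intro M _ _ _ _ _ ℳ hℳ ⟨c, hc⟩ hd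
  by_cases hkill : ∃ k, ∀ s ∈ X k, ∀ x : M, s • x = 0
  · obtain ⟨k, hk⟩ := hkill
    have hk' : ∀ s ∈ 𝒜 (Pi.single k 1), ∀ x : M, s • x = 0 := by
      intro s hs x
      have hle : Ideal.span (X k : Set S) ≤ LinearMap.ker (LinearMap.toSpanSingleton S M x) :=
        Ideal.span_le.2 fun t ht => hk t ht x
      exact hle (hspan k s hs)
    obtain ⟨e, he⟩ := hℳ.exists_component_eq_span h𝒜
    -- For `n ≥ e_k + e` we have `M_n = S_{e_k} M_{n - e_k}`, which is zero.
    refine ⟨0, Pi.single k 1 + e, fun n hn => ?_⟩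
    have hn' : natDeg e ≤ n - natDeg (Pi.single k 1) := by
      rw [le_sub_iff_add_le', ← natDeg_add]
      exact hn
    have : Subsingleton (ℳ n) := by
      refine ⟨fun y z => ?_⟩
      have h0 : ∀ y : ℳ n, y = 0 := by
        rintro ⟨y, hy⟩
        have h := he _ hn' (Pi.single k 1) y (by rwa [add_sub_cancel])
        have hle : Submodule.span R (Set.image2 (fun (s : S) (x : M) => s • x)
            (𝒜 (Pi.single k 1)) (ℳ (n - natDeg (Pi.single k 1)))) ≤ ⊥ := by
          rw [Submodule.span_le]
          rintro _ ⟨s, hs, x, -, rfl⟩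
          exact hk' s hs x
        exact Subtype.ext ((Submodule.mem_bot R).1 (hle h))
      rw [h0 y, h0 z]
    simp [Module.length_eq_zero]
  · push Not at hkill
    refine IsEventuallyPolynomial.of_differences fun k => ?_
    obtain ⟨s, hsX, x, hsx⟩ := hkill k
    have hs : s ∈ 𝒜 (Pi.single k 1) := hX k hsX
    let := hℳ.isInternal.chooseDecomposition
    set K := LinearMap.ker (LinearMap.lsmul S M s)
    set N := LinearMap.range (LinearMap.lsmul S M s)
    set A := {s : S | (∃ k, s ∈ X k) ∧ ∃ x : M, s • x ≠ 0}
    have hA : A.Finite := (Set.finite_iUnion fun k => (X k).finite_toSet).subset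
      fun t ht => Set.mem_iUnion.2 ht.1
    have hsA : s ∈ A := ⟨⟨k, hsX⟩, x, hsx⟩
    have hsmaller (B : Set S) (hBA : B ⊆ A) (hsB : s ∉ B) : B.ncard < d :=
      (Set.ncard_lt_ncard ⟨hBA, fun h => hsB (h hsA)⟩ hA).trans_le hd
    have hlen (n) : ∃ l : ℕ∞, Module.length R (ℳ n) =
          Module.length R (submoduleGrading ℳ K n) + l ∧
        Module.length R (ℳ (natDeg (Pi.single k 1) + n)) =
          l + Module.length R (quotientGrading ℳ N (natDeg (Pi.single k 1) + n)) :=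
      length_component_add hℳ hs n
    have hKlen (n) (hn : natDeg c ≤ n) : Module.length R (submoduleGrading ℳ K n) ≠ ⊤ := by
      obtain ⟨l, h1, -⟩ := hlen n
      exact ne_top_of_le_ne_top (hc n hn) (h1 ▸ le_self_add)
    have hNlen (n) (hn : natDeg c ≤ n) : Module.length R (quotientGrading ℳ N n) ≠ ⊤ :=
      ne_top_of_le_ne_top (hc n hn)
        (Module.length_le_of_surjective _ (componentMkQ_surjective N n))
    have hKpoly := ih _ (hsmaller {t | (∃ k, t ∈ X k) ∧ ∃ x : K, t • x ≠ 0}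
      (fun t ⟨ht, x, hx⟩ => ⟨ht, x, fun h => hx (Subtype.ext h)⟩)
      (fun ⟨_, x, hx⟩ => hx (Subtype.ext x.2))) K (submoduleGrading ℳ K)
      (hℳ.submodule (isGradedSubmodule_ker hℳ hs)) ⟨c, hKlen⟩ le_rfl
    have hNpoly := ih _ (hsmaller {t | (∃ k, t ∈ X k) ∧ ∃ x : M ⧸ N, t • x ≠ 0}
      (fun t ⟨ht, x, hx⟩ => by
        obtain ⟨x, rfl⟩ := N.mkQ_surjective x
        exact ⟨ht, x, fun h => hx (by rw [← map_smul, h, map_zero])⟩)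
      (fun ⟨_, x, hx⟩ => by
        obtain ⟨x, rfl⟩ := N.mkQ_surjective x
        exact hx ((Submodule.Quotient.mk_eq_zero N).2 ⟨x, rfl⟩))) (M ⧸ N) (quotientGrading ℳ N)
      (hℳ.quotient (isGradedSubmodule_range hℳ hs)) ⟨c, hNlen⟩ le_rfl
    obtain ⟨P, e, hP⟩ := (hNpoly.comp_add (Pi.single k 1)).sub hKpoly
    refine ⟨P, c ⊔ e, fun n hn => ?_⟩
    have hcn : natDeg c ≤ n := (natDeg_mono le_sup_left).trans hn
    have hcn' : natDeg c ≤ natDeg (Pi.single k 1) + n := hcn.trans fun j => by simp [natDeg]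
    rw [← hP n ((natDeg_mono le_sup_right).trans hn)]
    obtain ⟨l, h1, h2⟩ := hlen n
    -- `ENat.toNat` sends `⊤` to 0 and is additive only on finite values, hence all the finiteness
    -- checks.
    have hl : l ≠ ⊤ := ne_top_of_le_ne_top (hc n hcn) (h1 ▸ le_add_self)
    simp only [h1, h2, ENat.toNat_add (hKlen n hcn) hl, ENat.toNat_add hl (hNlen _ hcn')]
    push_cast
    ring

/-- Lengths of the components of a finitely generated graded module are eventually polynomial. -/
theorem IsMultigradedModule.length_isEventuallyPolynomial [IsNoetherianRing S] [Module.Finite S M]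
    (h𝒜 : IsStandardGraded 𝒜) (hℳ : IsMultigradedModule 𝒜 ℳ)
    (hlen : ∃ c : Fin r → ℕ, ∀ n : Fin r → ℤ, natDeg c ≤ n → Module.length R (ℳ n) ≠ ⊤) :
    IsEventuallyPolynomial fun n => ((Module.length R (ℳ n)).toNat : ℚ) := by
  choose X hX hspan using fun k : Fin r => exists_finset_generating_degree 𝒜 (Pi.single k 1)
  exact length_isEventuallyPolynomial_of_card h𝒜 X hX hspan _ M ℳ hℳ hlen le_rfl

end Hilbert

/-! ### Finite generation of `F(M)`. -/

section Functor

open DirectSum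

variable {r : ℕ} {R : Type u} {S : Type v} {M : Type u} [CommRing R] [CommRing S] [Algebra R S]
  [AddCommGroup M] [Module R M] [Module S M] [IsScalarTower R S M]
  {𝒜 : (Fin r → ℕ) → Submodule R S} [GradedAlgebra 𝒜] {ℳ : (Fin r → ℤ) → Submodule R M}
  [IsNoetherianRing S] [Module.Finite S M] (h𝒜 : IsStandardGraded 𝒜)
  (hℳ : IsMultigradedModule 𝒜 ℳ)

namespace FunctorSum

theorem of_injective (F : FGModuleCat.{u} R ⥤ ModuleCat.{u} R) (n : Fin r → ℤ) :
    Function.Injective (of h𝒜 hℳ F n) :=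
  DirectSum.of_injective (β := fun n => F.obj (gradedPiece h𝒜 hℳ n)) n

/-- The component of degree `n` of `F(M)` is `F(M_n)`. -/
noncomputable def componentEquiv (F : FGModuleCat.{u} R ⥤ ModuleCat.{u} R) (n : Fin r → ℤ) :
    F.obj (gradedPiece h𝒜 hℳ n) ≃ₗ[R] component h𝒜 hℳ F n :=
  LinearEquiv.ofInjective _ (of_injective h𝒜 hℳ F n)

variable {h𝒜 hℳ} in
theorem induction_on {F : FGModuleCat.{u} R ⥤ ModuleCat.{u} R}
    {p : FunctorSum h𝒜 hℳ F → Prop} (x : FunctorSum h𝒜 hℳ F) (zero : p 0)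
    (of : ∀ n x, p (of h𝒜 hℳ F n x)) (add : ∀ x y, p x → p y → p (x + y)) : p x :=
  DirectSum.induction_on (β := fun n => F.obj (gradedPiece h𝒜 hℳ n)) x zero of add

/-- The projection of `F(M)` onto `F(M_n)`. -/
noncomputable def proj (F : FGModuleCat.{u} R ⥤ ModuleCat.{u} R) (n : Fin r → ℤ) :
    FunctorSum h𝒜 hℳ F →ₗ[R] F.obj (gradedPiece h𝒜 hℳ n) :=
  DirectSum.component R _ (fun n => F.obj (gradedPiece h𝒜 hℳ n)) n

theorem proj_of_same (F : FGModuleCat.{u} R ⥤ ModuleCat.{u} R) (n : Fin r → ℤ)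
    (x : F.obj (gradedPiece h𝒜 hℳ n)) : proj h𝒜 hℳ F n (of h𝒜 hℳ F n x) = x :=
  DirectSum.component.lof_self (M := fun n => F.obj (gradedPiece h𝒜 hℳ n)) R n x

theorem proj_of_ne (F : FGModuleCat.{u} R ⥤ ModuleCat.{u} R) {n m : Fin r → ℤ} (h : m ≠ n)
    (x : F.obj (gradedPiece h𝒜 hℳ m)) : proj h𝒜 hℳ F n (of h𝒜 hℳ F m x) = 0 :=
  (DirectSum.component.of (M := fun n => F.obj (gradedPiece h𝒜 hℳ n)) R n m x).trans
    (dif_neg h)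

theorem ext_proj {F : FGModuleCat.{u} R ⥤ ModuleCat.{u} R} {x y : FunctorSum h𝒜 hℳ F}
    (h : ∀ n, proj h𝒜 hℳ F n x = proj h𝒜 hℳ F n y) : x = y :=
  DirectSum.ext_component (M := fun n => F.obj (gradedPiece h𝒜 hℳ n)) R h

theorem isMultigradedModule_component (F : FGModuleCat.{u} R ⥤ ModuleCat.{u} R) [F.Additive]
    [F.Linear R] : IsMultigradedModule 𝒜 (component h𝒜 hℳ F) where
  isInternal := by
    refine isInternal_of_projections _ (fun n => of h𝒜 hℳ F n ∘ₗ proj h𝒜 hℳ F n) ?_ ?_ ?_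
    · rintro n _ ⟨x, rfl⟩
      rw [LinearMap.comp_apply, proj_of_same]
    · rintro n m h _ ⟨x, rfl⟩
      rw [LinearMap.comp_apply, proj_of_ne h𝒜 hℳ F h, map_zero]
    · refine eq_top_iff.2 fun x _ => ?_
      induction x using FunctorSum.induction_on with
      | zero => exact zero_mem _
      | of n x => exact Submodule.mem_iSup_of_mem n ⟨x, rfl⟩
      | add x y hx hy => exact add_mem (hx trivial) (hy trivial)
  smul_mem := by
    rintro i n s _ hs ⟨x, rfl⟩
    exact ⟨_, (smul_of h𝒜 hℳ F hs n x).symm⟩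

/-- `S`-linearity of a map out of `F(M)` can be checked on homogeneous elements. -/
noncomputable def homOfHomogeneous {F : FGModuleCat.{u} R ⥤ ModuleCat.{u} R} [F.Additive]
    [F.Linear R] {P : Type*} [AddCommGroup P] [Module R P] [Module S P]
    (f : FunctorSum h𝒜 hℳ F →ₗ[R] P)
    (h : ∀ (i : Fin r → ℕ), ∀ s ∈ 𝒜 i, ∀ n x,
      f (s • of h𝒜 hℳ F n x) = s • f (of h𝒜 hℳ F n x)) :
    FunctorSum h𝒜 hℳ F →ₗ[S] P where
  toFun := f
  map_add' := map_add f
  map_smul' s x := by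
    rw [RingHom.id_apply]
    induction s using Decomposition.inductionOn 𝒜 with
    | zero => simp
    | add a b ha hb => rw [add_smul, map_add, add_smul, ha, hb]
    | @homogeneous i s =>
      induction x using FunctorSum.induction_on with
      | zero => simp
      | of n x => exact h i s s.2 n x
      | add x y hx hy => rw [smul_add, map_add, map_add, smul_add, hx, hy]

/-- A natural transformation induces an `S`-linear map. -/
noncomputable def mapNatTrans {F G : FGModuleCat.{u} R ⥤ ModuleCat.{u} R} [F.Additive]
    [F.Linear R] [G.Additive] [G.Linear R] (π : G ⟶ F) :
    FunctorSum h𝒜 hℳ G →ₗ[S] FunctorSum h𝒜 hℳ F :=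
  homOfHomogeneous h𝒜 hℳ
    (desc fun n => of h𝒜 hℳ F n ∘ₗ (π.app (gradedPiece h𝒜 hℳ n)).hom) fun i s hs n x => by
      rw [smul_of h𝒜 hℳ G hs, desc_of, desc_of, LinearMap.comp_apply, LinearMap.comp_apply,
        smul_of h𝒜 hℳ F hs]
      congr 1
      exact LinearMap.congr_fun (congrArg ModuleCat.Hom.hom (π.naturality (gradedPieceMul h𝒜 hℳ s
        fun x hx => hℳ.smul_mem i n s x hs hx))) x

theorem mapNatTrans_surjective {F G : FGModuleCat.{u} R ⥤ ModuleCat.{u} R} [F.Additive]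
    [F.Linear R] [G.Additive] [G.Linear R] (π : G ⟶ F)
    (hπ : ∀ N, Function.Surjective (π.app N).hom) :
    Function.Surjective (mapNatTrans h𝒜 hℳ π) := by
  intro y
  induction y using FunctorSum.induction_on with
  | zero => exact ⟨0, map_zero _⟩
  | of n y =>
    obtain ⟨x, rfl⟩ := hπ _ y
    exact ⟨of h𝒜 hℳ G n x, desc_of _ n x⟩
  | add x y hx hy =>
    obtain ⟨x, rfl⟩ := hx
    obtain ⟨y, rfl⟩ := hy
    exact ⟨x + y, map_add _ x y⟩

instance linear_linearCoyoneda_obj (L : FGModuleCat.{u} R) :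
    ((linearCoyoneda R (FGModuleCat.{u} R)).obj (Opposite.op L)).Linear R where
  map_smul f a := by
    ext g
    exact Linear.comp_smul _ _ _ g a f

/-- Evaluation at an element of `L`, as a map `Hom(L, M_n) → M`. -/
def evalComponent {L : FGModuleCat.{u} R} (l : L) (n : Fin r → ℤ) :
    ((linearCoyoneda R (FGModuleCat.{u} R)).obj (Opposite.op L)).obj (gradedPiece h𝒜 hℳ n)
      →ₗ[R] M where
  toFun f := (ℳ n).subtype ((InducedCategory.Hom.hom f).hom l)
  map_add' _ _ := rfl
  map_smul' _ _ := rfl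

/-- Evaluation at an element of `L`, as an `S`-linear map from the sum of the modules
`Hom(L, M_n)` to `M`. -/
noncomputable def evalHom {L : FGModuleCat.{u} R} (l : L) :
    FunctorSum h𝒜 hℳ ((linearCoyoneda R (FGModuleCat.{u} R)).obj (Opposite.op L)) →ₗ[S] M :=
  homOfHomogeneous h𝒜 hℳ (desc (evalComponent h𝒜 hℳ l)) fun i s hs n x => by
    rw [smul_of h𝒜 hℳ _ hs, desc_of, desc_of]
    rfl

theorem gradedProj_evalHom [Decomposition ℳ] {L : FGModuleCat.{u} R} (l : L) (n : Fin r → ℤ)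
    (x : FunctorSum h𝒜 hℳ ((linearCoyoneda R (FGModuleCat.{u} R)).obj (Opposite.op L))) :
    gradedProj ℳ n (evalHom h𝒜 hℳ l x) = evalComponent h𝒜 hℳ l n (proj h𝒜 hℳ _ n x) := by
  have h : gradedProj ℳ n ∘ₗ desc (evalComponent h𝒜 hℳ l) =
      evalComponent h𝒜 hℳ l n ∘ₗ proj h𝒜 hℳ _ n := by
    refine hom_ext fun m f => ?_
    rw [LinearMap.comp_apply, LinearMap.comp_apply, desc_of]
    have hmem : evalComponent h𝒜 hℳ l m f ∈ ℳ m :=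
      Subtype.property (p := (· ∈ ℳ m)) _
    by_cases hmn : m = n
    · subst hmn
      rw [proj_of_same, gradedProj_same ℳ hmem]
    · rw [proj_of_ne h𝒜 hℳ _ hmn, map_zero, gradedProj_ne ℳ hmn hmem]
  exact LinearMap.congr_fun h x

/-- A homomorphism is determined by its values on generators of `L`, so evaluation at them is an
injective `S`-linear map into a finite power of the Noetherian module `M`. -/
theorem finite_linearCoyoneda (L : FGModuleCat.{u} R) :
    Module.Finite S
      (FunctorSum h𝒜 hℳ ((linearCoyoneda R (FGModuleCat.{u} R)).obj (Opposite.op L))) := by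
  let := hℳ.isInternal.chooseDecomposition
  obtain ⟨k, g, hg⟩ := Module.Finite.exists_fin (R := R) (M := L)
  let ev := LinearMap.pi fun j : Fin k => evalHom h𝒜 hℳ (g j)
  refine Module.Finite.of_injective ev ((injective_iff_map_eq_zero ev).2 fun x hx => ?_)
  refine ext_proj h𝒜 hℳ fun n => ?_
  rw [map_zero]
  -- The value of the `n`-th summand at `g j` is the degree `n` component of `evalHom (g j) x`,
  -- which is zero.
  refine FGModuleCat.hom_ext (LinearMap.ext_on_range hg fun j => Subtype.ext ?_)
  refine (gradedProj_evalHom h𝒜 hℳ (g j) n x).symm.trans ?_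
  have : evalHom h𝒜 hℳ (g j) x = 0 := congrFun hx j
  rw [this, map_zero]
  rfl

theorem finite (F : FGModuleCat.{u} R ⥤ ModuleCat.{u} R) [F.Additive] [F.Linear R]
    (hF : IsCoherentFunctor F) : Module.Finite S (FunctorSum h𝒜 hℳ F) := by
  obtain ⟨K, L, φ, π, h⟩ := hF
  have := finite_linearCoyoneda h𝒜 hℳ L
  exact Module.Finite.of_surjective _ (mapNatTrans_surjective h𝒜 hℳ π fun N => (h N).2)

end FunctorSum

end Functor

theorem theorem2p1 {r : ℕ} {R : Type u} {S : Type v} {M : Type u} [CommRing R] [CommRing S]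
    [Algebra R S] [AddCommGroup M] [Module R M] [Module S M] [IsScalarTower R S M]
    (𝒜 : (Fin r → ℕ) → Submodule R S) [GradedAlgebra 𝒜] (ℳ : (Fin r → ℤ) → Submodule R M)
    [IsNoetherianRing S] [Module.Finite S M]
    (h𝒜 : IsStandardGraded 𝒜) (hℳ : IsMultigradedModule 𝒜 ℳ)
    (F : FGModuleCat.{u} R ⥤ ModuleCat.{u} R) [F.Additive] [F.Linear R]
    (hF : IsCoherentFunctor F) :
    (IsMultigradedModule 𝒜 (FunctorSum.component h𝒜 hℳ F) ∧
      Module.Finite S (FunctorSum h𝒜 hℳ F)) ∧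
    StabilizesAsymptotically
      (fun n : Fin r → ℤ => associatedPrimes R (F.obj (gradedPiece h𝒜 hℳ n))) ∧
    (∀ J : Ideal R, J ≠ ⊥ → StabilizesAsymptotically
      (fun n : Fin r → ℤ => moduleGrade J (F.obj (gradedPiece h𝒜 hℳ n)))) ∧
    ((∃ c : Fin r → ℕ, ∀ n : Fin r → ℤ, natDeg c ≤ n →
        Module.length R (F.obj (gradedPiece h𝒜 hℳ n)) ≠ ⊤) →
      ∃ (P : MvPolynomial (Fin r) ℚ) (c : Fin r → ℕ), ∀ n : Fin r → ℤ, natDeg c ≤ n →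
        ∃ l : ℕ, Module.length R (F.obj (gradedPiece h𝒜 hℳ n)) = l ∧
          (l : ℚ) = MvPolynomial.eval (fun k => (n k : ℚ)) P) := by
  have hfin := FunctorSum.finite h𝒜 hℳ F hF
  have hgr := FunctorSum.isMultigradedModule_component h𝒜 hℳ F
  have e := FunctorSum.componentEquiv h𝒜 hℳ F
  have hass (n) := LinearEquiv.AssociatedPrimes.eq (e n)
  have hgrade (J n) := moduleGrade_congr J (e n)
  have hlength (n) := (e n).length_eq
  -- All three invariants are unchanged under `F(M_n) ≅ F(M)_n`, so only the graded module `F(M)`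
  -- remains.
  simp only [hass, hgrade, hlength]
  refine ⟨⟨hgr, hfin⟩, hgr.stabilizes_associatedPrimes h𝒜,
    fun J _ => hgr.stabilizes_moduleGrade h𝒜 J, fun ⟨c, hc⟩ => ?_⟩
  obtain ⟨P, d, hP⟩ := hgr.length_isEventuallyPolynomial h𝒜 ⟨c, hc⟩
  refine ⟨P, c ⊔ d, fun n hn => ⟨_, (ENat.natCast_toNat (hc n ?_)).symm, hP n ?_⟩⟩
  · exact (natDeg_mono le_sup_left).trans hn
  · exact (natDeg_mono le_sup_right).trans hn
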